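/- Let $n\ge 1$, let $a\in(0,1)$ and $b=\sqrt{1-a^2}$, and let $$\mathbb S(a)=\{(x,b)\in\mathbb R^{n}\times\mathbb R : |x|=a\}\subset \mathbb S^n\subset\mathbb R^{n+1}$$ be the hypersphere of radius $a$ of the unit sphere $\mathbb S^n$; both carry the metrics induced by $\mathbb R^{n+1}$. For a smooth map $\varphi:(M,g)\to(N,h)$ between Riemannian manifolds, let $\delta T\varphi=-\operatorname{tr}_g\nabla T\varphi$, let $\Delta=\delta\nabla=-\operatorname{tr}_g\nabla^2$ be the rough Laplacian on sections of $\varphi^*TN$, and let $\mathcal S(X)=\operatorname{tr}_g R^h_{X,T\varphi}T\varphi$, where $R^h_{X,Y}Z=\nabla_X\nabla_YZ-\nabla_Y\nabla_XZ-\nabla_{[X,Y]}Z$ is the curvature tensor of $h$. The map $\varphi$ is called harmonic if $\delta T\varphi=0$; it is called biharmonic of index $k\in\mathbb R$ if $$\Delta\,\delta T\varphi-\mathcal S(\delta T\varphi)+k\,\delta T\varphi=0,$$ and properly biharmonic of index $k$ if it is moreover not harmonic. A submanifold, with its induced metric, is called harmonic, respectively (properly) biharmonic of index $k$, if its inclusion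 is. Let $M$ be a non-empty smooth (possibly immersed) submanifold, without boundary and of dimension $m\ge 1$, of $\mathbb S(a)$. Then $M$ is harmonic (i.e. minimal) in $\mathbb S(a)$ if and only if $M$ is properly biharmonic of index $m\left(1-\frac{b^2}{a^2}\right)$ in $\mathbb S^n$. -/

import Mathlib

open scoped Manifold ContDiff Topology

noncomputable section

namespace Biharm

/-- The Euclidean space `ℝⁿ`. -/
abbrev Eu (n : ℕ) : Type := EuclideanSpace ℝ (Fin n)

/-! ### Riemannian calculus in local coordinates -/

/-- The partial derivative `∂ᵢ f`. -/
def pd {m : ℕ} (i : Fin m) (f : Eu m → ℝ) (u : Eu m) : ℝ :=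
  fderiv ℝ f u (EuclideanSpace.single i 1)

/-- The Christoffel symbol `Γᵏᵢⱼ = ½ gᵏˡ (∂ᵢ gⱼₗ + ∂ⱼ gᵢₗ - ∂ₗ gᵢⱼ)` of the Levi-Civita connection of
the metric with coefficients `g`. -/
def christoffel {m : ℕ} (g : Eu m → Matrix (Fin m) (Fin m) ℝ) (k i j : Fin m) (u : Eu m) : ℝ :=
  (1 / 2) * ∑ l, (g u)⁻¹ k l *
    (pd i (fun v => g v j l) u + pd j (fun v => g v i l) u - pd l (fun v => g v i j) u)

/-- The component `Rᵅ_βγδ` of the curvature tensor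
`R_{X,Y} Z = ∇_X ∇_Y Z - ∇_Y ∇_X Z - ∇_[X,Y] Z` (positive on round spheres), with
`R_{∂γ,∂δ} ∂β = Rᵅ_βγδ ∂α`. -/
def curvature {n : ℕ} (h : Eu n → Matrix (Fin n) (Fin n) ℝ) (α β γ δ : Fin n) (y : Eu n) : ℝ :=
  pd γ (christoffel h α δ β) y - pd δ (christoffel h α γ β) y
    + ∑ ε, (christoffel h α γ ε y * christoffel h ε δ β y
      - christoffel h α δ ε y * christoffel h ε γ β y)

/-- The components of `TF(∂ⱼ)`, a section of `F^* TN`. -/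
def tangentMap {m n : ℕ} (F : Eu m → Eu n) (j : Fin m) (u : Eu m) : Fin n → ℝ :=
  fun α => pd j (fun v => F v α) u

/-- The connection on `F^* TN` pulled back from the Levi-Civita connection of `h`:
`(∇ᵢ V)ᵅ = ∂ᵢ Vᵅ + Γᵅ_βγ(F) ∂ᵢFᵝ Vᵞ`. -/
def pullbackNabla {m n : ℕ} (h : Eu n → Matrix (Fin n) (Fin n) ℝ) (F : Eu m → Eu n)
    (i : Fin m) (V : Eu m → Fin n → ℝ) (u : Eu m) : Fin n → ℝ :=
  fun α => pd i (fun v => V v α) u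
    + ∑ β, ∑ γ, christoffel h α β γ (F u) * tangentMap F i u β * V u γ

/-- The divergence on one-forms `θ = θⱼ duʲ` with values in `F^* TN`:
`δθ = - tr_g ∇θ = - gⁱʲ (∇ᵢ θⱼ - Γᵏᵢⱼ θₖ)`. -/
def divergence {m n : ℕ} (g : Eu m → Matrix (Fin m) (Fin m) ℝ)
    (h : Eu n → Matrix (Fin n) (Fin n) ℝ) (F : Eu m → Eu n)
    (θ : Fin m → Eu m → Fin n → ℝ) (u : Eu m) : Fin n → ℝ :=
  fun α => - ∑ i, ∑ j, (g u)⁻¹ i j *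
    (pullbackNabla h F i (θ j) u α - ∑ k, christoffel g k i j u * θ k u α)

/-- The section `δTF` of `F^* TN` (the opposite of the tension field of `F`). -/
def deltaT {m n : ℕ} (g : Eu m → Matrix (Fin m) (Fin m) ℝ)
    (h : Eu n → Matrix (Fin n) (Fin n) ℝ) (F : Eu m → Eu n) : Eu m → Fin n → ℝ :=
  divergence g h F (tangentMap F)

/-- The rough Laplacian `Δ = δ∇` on sections of `F^* TN` (a nonnegative operator). -/
def roughLaplacian {m n : ℕ} (g : Eu m → Matrix (Fin m) (Fin m) ℝ)
    (h : Eu n → Matrix (Fin n) (Fin n) ℝ) (F : Eu m → Eu n)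
    (V : Eu m → Fin n → ℝ) : Eu m → Fin n → ℝ :=
  divergence g h F (fun j => pullbackNabla h F j V)

/-- The endomorphism `S(X) = tr_g R_{X,TF} TF` of `F^* TN`, where `R` is the curvature of `h`. -/
def curvatureTrace {m n : ℕ} (g : Eu m → Matrix (Fin m) (Fin m) ℝ)
    (h : Eu n → Matrix (Fin n) (Fin n) ℝ) (F : Eu m → Eu n)
    (X : Eu m → Fin n → ℝ) (u : Eu m) : Fin n → ℝ :=
  fun α => ∑ i, ∑ j, (g u)⁻¹ i j * ∑ β, ∑ γ, ∑ δ,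
    curvature h α β γ δ (F u) * X u γ * tangentMap F i u δ * tangentMap F j u β

/-! ### Harmonic and biharmonic maps between Riemannian manifolds -/

/-- A (0,2)-tensor on the tangent spaces of a manifold `M` of dimension `m`; below it is always a
Riemannian metric. -/
abbrev MetricTensor (m : ℕ) (M : Type*) [TopologicalSpace M] [ChartedSpace (Eu m) M] : Type _ :=
  ∀ x : M, TangentSpace (𝓡 m) x → TangentSpace (𝓡 m) x → ℝ

section Global

variable {m n : ℕ} {M N : Type*} [TopologicalSpace M] [ChartedSpace (Eu m) M]
  [TopologicalSpace N] [ChartedSpace (Eu n) N]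

/-- The metric induced on `M` by an immersion `f` into a Euclidean space. -/
def inducedMetric {q : ℕ} (f : M → Eu q) : MetricTensor m M := fun x v w =>
  inner (𝕜 := ℝ) (E := Eu q) (mfderiv (𝓡 m) (𝓡 q) f x v) (mfderiv (𝓡 m) (𝓡 q) f x w)

/-- The coefficients `g(∂ᵢ, ∂ⱼ)` of a metric in the preferred chart at `p`. -/
def metricInChart (g : MetricTensor m M) (p : M) (u : Eu m) : Matrix (Fin m) (Fin m) ℝ :=
  Matrix.of fun i j =>
    g ((chartAt (Eu m) p).symm u)
      (mfderiv (𝓡 m) (𝓡 m) (chartAt (Eu m) p).symm u (EuclideanSpace.single i (1 : ℝ) : Eu m))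
      (mfderiv (𝓡 m) (𝓡 m) (chartAt (Eu m) p).symm u (EuclideanSpace.single j (1 : ℝ) : Eu m))

/-- The map `φ` in the preferred charts at `p` and at `φ p`. -/
def mapInCharts (φ : M → N) (p : M) (u : Eu m) : Eu n :=
  chartAt (Eu n) (φ p) (φ ((chartAt (Eu m) p).symm u))

/-- The smooth map `φ : (M, g) → (N, h)` is harmonic: `δTφ = 0` near every point, in the preferred
coordinates there. -/
def IsHarmonic (g : MetricTensor m M) (h : MetricTensor n N) (φ : M → N) : Prop :=
  ∀ p : M, ∀ᶠ u in 𝓝 (chartAt (Eu m) p p),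
    deltaT (metricInChart g p) (metricInChart h (φ p)) (mapInCharts φ p) u = 0

/-- The smooth map `φ : (M, g) → (N, h)` is biharmonic of index `k`:
`Δ δTφ - S(δTφ) + k δTφ = 0` near every point, in the preferred coordinates there. -/
def IsBiharmonicOfIndex (k : ℝ) (g : MetricTensor m M) (h : MetricTensor n N) (φ : M → N) :
    Prop :=
  ∀ p : M, ∀ᶠ u in 𝓝 (chartAt (Eu m) p p),
    let G := metricInChart g p
    let H := metricInChart h (φ p)
    let F := mapInCharts φ p
    roughLaplacian G H F (deltaT G H F) u - curvatureTrace G H F (deltaT G H F) u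
      + k • deltaT G H F u = 0

/-- The map `φ` is properly biharmonic of index `k`. -/
def IsProperlyBiharmonicOfIndex (k : ℝ) (g : MetricTensor m M) (h : MetricTensor n N)
    (φ : M → N) : Prop :=
  IsBiharmonicOfIndex k g h φ ∧ ¬ IsHarmonic g h φ

end Global

/-! ### The unit sphere and its hyperspheres -/

/-- The unit sphere `Sⁿ` of `ℝⁿ⁺¹`, with Mathlib's manifold structure. -/
abbrev Sph (n : ℕ) : Type := Metric.sphere (0 : Eu (n + 1)) 1

/-- The canonical metric of `Sⁿ`. -/
def roundMetric (n : ℕ) : MetricTensor n (Sph n) := inducedMetric (fun x => (x : Eu (n + 1)))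

/-- The last coordinate `b = √(1 - a²)` of the points of the hypersphere of radius `a`. -/
def height (a : Set.Ioc (0 : ℝ) 1) : ℝ := √(1 - (a : ℝ) ^ 2)

theorem height_sq (a : Set.Ioc (0 : ℝ) 1) : height a ^ 2 = 1 - (a : ℝ) ^ 2 :=
  Real.sq_sqrt (by nlinarith [a.2.1, a.2.2])

/-- The hypersphere `Sᵈ(a) = {(x, b) | x ∈ ℝᵈ⁺¹, |x| = a}` of `Sᵈ⁺¹`, where `b = √(1 - a²)`. -/
def hypersphere (d : ℕ) (a : Set.Ioc (0 : ℝ) 1) : Set (Eu (d + 2)) :=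
  {p | ‖(WithLp.toLp 2 (fun i : Fin (d + 1) => p i.castSucc) : Eu (d + 1))‖ = a ∧
    p (Fin.last (d + 1)) = height a}

theorem hypersphere_subset (d : ℕ) (a : Set.Ioc (0 : ℝ) 1) :
    hypersphere d a ⊆ Metric.sphere (0 : Eu (d + 2)) 1 := by
  rintro p ⟨h1, h2⟩
  have h3 := congrArg (· ^ 2) h1
  simp only [EuclideanSpace.norm_sq_eq, Real.norm_eq_abs, sq_abs] at h3
  rw [mem_sphere_zero_iff_norm, EuclideanSpace.norm_eq, Real.sqrt_eq_one]
  simp only [Real.norm_eq_abs, sq_abs]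
  rw [Fin.sum_univ_castSucc, h3, h2, height_sq]
  ring

/-- The inclusion `Sᵈ(a) ⊂ Sᵈ⁺¹`. -/
def hypersphereIncl (d : ℕ) (a : Set.Ioc (0 : ℝ) 1) : hypersphere d a → Sph (d + 1) :=
  Set.inclusion (hypersphere_subset d a)

/-- The homeomorphism `(x, b) ↦ x / a` from `Sᵈ(a)` to the unit sphere `Sᵈ`. -/
def hypersphereHomeo (d : ℕ) (a : Set.Ioc (0 : ℝ) 1) : hypersphere d a ≃ₜ Sph d where
  toFun p := ⟨(a : ℝ)⁻¹ • (WithLp.toLp 2 (fun i : Fin (d + 1) => p.1 i.castSucc) : Eu (d + 1)), by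
    rw [mem_sphere_zero_iff_norm, norm_smul, p.2.1, Real.norm_eq_abs,
      abs_of_pos (inv_pos.2 a.2.1), inv_mul_cancel₀ a.2.1.ne']⟩
  invFun x := ⟨WithLp.toLp 2 (Fin.snoc (α := fun _ => ℝ) (fun i => (a : ℝ) * x.1 i) (height a)), by
    refine ⟨?_, by simp⟩
    have hx : ‖x.1‖ = 1 := mem_sphere_zero_iff_norm.1 x.2
    have : (WithLp.toLp 2 (fun i : Fin (d + 1) => (a : ℝ) * x.1 i) : Eu (d + 1)) =
        (a : ℝ) • x.1 := by
      ext i; simp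
    simp [this, norm_smul, hx, abs_of_pos a.2.1]⟩
  left_inv p := by
    apply Subtype.ext
    ext i
    refine Fin.lastCases ?_ (fun j => ?_) i
    · simp [p.2.2]
    · simp [mul_inv_cancel_left₀ a.2.1.ne']
  right_inv x := by
    apply Subtype.ext
    ext i
    simp [inv_mul_cancel_left₀ a.2.1.ne']
  continuous_toFun := by fun_prop
  continuous_invFun := by
    refine Continuous.subtype_mk ?_ _
    refine (PiLp.continuous_toLp 2 _).comp (continuous_pi fun i => ?_)
    refine Fin.lastCases ?_ (fun j => ?_) i
    · simpa using continuous_const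
    · simp only [Fin.snoc_castSucc]
      fun_prop

/-- The manifold structure of `Sᵈ(a)`: the charts are those of the unit sphere `Sᵈ`, read through
the homothety `(x, b) ↦ x / a`. -/
instance (d : ℕ) (a : Set.Ioc (0 : ℝ) 1) : ChartedSpace (Eu d) (hypersphere d a) where
  atlas := (fun c => (hypersphereHomeo d a).toOpenPartialHomeomorph.trans c) '' atlas (Eu d) (Sph d)
  chartAt p :=
    (hypersphereHomeo d a).toOpenPartialHomeomorph.trans (chartAt (Eu d) (hypersphereHomeo d a p))
  mem_chart_source p := by simp
  chart_mem_atlas p := ⟨_, chart_mem_atlas _ _, rfl⟩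

instance (d : ℕ) (a : Set.Ioc (0 : ℝ) 1) : IsManifold (𝓡 d) ω (hypersphere d a) where
  compatible := by
    rintro _ _ ⟨c, hc, rfl⟩ ⟨c', hc', rfl⟩
    refine (contDiffGroupoid ω (𝓡 d)).mem_of_eqOnSource
      (StructureGroupoid.compatible (contDiffGroupoid ω (𝓡 d)) hc hc') ?_
    refine ⟨?_, ?_⟩
    · ext x
      simp
    · intro x _
      simp

/-- The metric of `Sᵈ(a)`, induced by the ambient Euclidean space. -/
def hypersphereMetric (d : ℕ) (a : Set.Ioc (0 : ℝ) 1) : MetricTensor d (hypersphere d a) :=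
  inducedMetric (fun x => (x : Eu (d + 2)))

end Biharm

end

/-! Everything is computed in the ambient Euclidean space. Let `f` be the immersion of `M` in
`ℝ^{d+2}` read in a chart, `e` the last basis vector, `b` the height, and `T = lap g f` the
vector-valued Laplacian of `f`. Since `|f| = 1` and `⟪f, e⟫ = b`, always `T ⊥ ∂ᵢf`, `⟪T, f⟫ = m` and
`⟪T, e⟫ = 0`.

The section `δTφ` into the hypersphere is the tangential part of `T`, so harmonicity there says that
`T` lies in the normal plane spanned by `f - b e` and `e`. The scalar products above then force `T =
(m / a²)(f - b e)` (`deltaT_eq_zero_iff_lap_eq`).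

In the unit sphere, `δTφ` is `V = T - m f`, which is normal to `M`. Constant curvature one gives
`S(V) = m V`, and the Gauss formula applied twice gives `lap V - |V|² f` for the rough Laplacian, so
the equation of index `k` reads `lap V - |V|² f + (k - m) V = 0` (`push_bitension_of_sphere`). If `T
= (m / a²)(f - b e)`, then `V` is affine in `f` and the equation is a direct check. Conversely, `⟪V,
e⟫ = -m b` is constant, so in the `e`-component the term `lap V` drops out; as `b ≠ 0`, what remains
gives `|V|² = m² b² / a²`, that is `|T|² = m² / a²`. This is the least norm compatible with `⟪T, f -
b e⟫ = m`, and the equality case of Cauchy–Schwarz gives the formula for `T`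
(`lap_eq_of_bitension_eq_zero`). Finally `⟪V, e⟫ = -m b ≠ 0` excludes harmonicity in the unit
sphere. -/

noncomputable section

namespace Biharm

/-! ### Partial derivatives -/

section Calculus

variable {m n q : ℕ} {E : Type*} [NormedAddCommGroup E] [InnerProductSpace ℝ E]

/-- The partial derivative `∂ᵢ f` of a vector-valued map. -/
def vpd (i : Fin m) (f : Eu m → E) (u : Eu m) : E :=
  fderiv ℝ f u (EuclideanSpace.single i 1)

theorem pd_eq_vpd (i : Fin m) (f : Eu m → ℝ) (u : Eu m) : pd i f u = vpd i f u := rfl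

theorem vpd_congr {U : Set (Eu m)} (hU : IsOpen U) {f g : Eu m → E} (h : Set.EqOn f g U)
    (i : Fin m) {u : Eu m} (hu : u ∈ U) : vpd i f u = vpd i g u := by
  unfold vpd
  rw [(h.eventuallyEq_of_mem (hU.mem_nhds hu)).fderiv_eq]

theorem pd_congr {U : Set (Eu m)} (hU : IsOpen U) {f g : Eu m → ℝ} (h : Set.EqOn f g U)
    (i : Fin m) {u : Eu m} (hu : u ∈ U) : pd i f u = pd i g u :=
  vpd_congr hU h i hu

theorem contDiffOn_vpd {U : Set (Eu m)} (hU : IsOpen U) {f : Eu m → E} (hf : ContDiffOn ℝ ∞ f U)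
    (i : Fin m) : ContDiffOn ℝ ∞ (vpd i f) U :=
  (hf.fderiv_of_isOpen hU (by simp)).clm_apply contDiffOn_const

theorem contDiffOn_pd {U : Set (Eu m)} (hU : IsOpen U) {f : Eu m → ℝ} (hf : ContDiffOn ℝ ∞ f U)
    (i : Fin m) : ContDiffOn ℝ ∞ (pd i f) U :=
  contDiffOn_vpd hU hf i

theorem differentiableAt_of_contDiffOn {G : Type*} [NormedAddCommGroup G] [NormedSpace ℝ G]
    {U : Set (Eu m)} (hU : IsOpen U) {f : Eu m → G}
    (hf : ContDiffOn ℝ ∞ f U) {u : Eu m} (hu : u ∈ U) : DifferentiableAt ℝ f u :=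
  (hf.contDiffAt (hU.mem_nhds hu)).differentiableAt (by simp)

theorem vpd_const (i : Fin m) (c : E) (u : Eu m) : vpd i (fun _ => c) u = 0 := by
  simp [vpd]

theorem vpd_inner {f g : Eu m → E} {u : Eu m} (hf : DifferentiableAt ℝ f u)
    (hg : DifferentiableAt ℝ g u) (i : Fin m) :
    pd i (fun v => inner ℝ (f v) (g v)) u =
      inner ℝ (vpd i f u) (g u) + inner ℝ (f u) (vpd i g u) := by
  simp only [pd, vpd]
  rw [fderiv_inner_apply ℝ hf hg, add_comm]

theorem vpd_sub {f g : Eu m → E} {u : Eu m} (hf : DifferentiableAt ℝ f u)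
    (hg : DifferentiableAt ℝ g u) (i : Fin m) :
    vpd i (fun v => f v - g v) u = vpd i f u - vpd i g u := by
  simp only [vpd]
  rw [fderiv_fun_sub hf hg]; rfl

theorem vpd_smul {c : Eu m → ℝ} {g : Eu m → E} {u : Eu m} (hc : DifferentiableAt ℝ c u)
    (hg : DifferentiableAt ℝ g u) (i : Fin m) :
    vpd i (fun v => c v • g v) u = pd i c u • g u + c u • vpd i g u := by
  simp only [vpd, pd]
  rw [fderiv_fun_smul hc hg, add_comm]; rfl

theorem vpd_const_smul {g : Eu m → E} {u : Eu m} (c : ℝ)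
    (hg : DifferentiableAt ℝ g u) (i : Fin m) :
    vpd i (fun v => c • g v) u = c • vpd i g u := by
  simp only [vpd]
  rw [fderiv_fun_const_smul hg]; rfl

theorem vpd_sum {ι : Type*} (s : Finset ι) {f : ι → Eu m → E} {u : Eu m}
    (hf : ∀ a ∈ s, DifferentiableAt ℝ (f a) u) (i : Fin m) :
    vpd i (fun v => ∑ a ∈ s, f a v) u = ∑ a ∈ s, vpd i (f a) u := by
  simp only [vpd]
  rw [fderiv_fun_sum hf, sum_apply]

theorem pd_coord {F : Eu m → Eu n} {u : Eu m} (hF : DifferentiableAt ℝ F u) (i : Fin m)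
    (β : Fin n) : pd i (fun v => F v β) u = vpd i F u β := by
  have h := ((EuclideanSpace.proj (𝕜 := ℝ) β : Eu n →L[ℝ] ℝ).hasFDerivAt.comp u hF.hasFDerivAt)
  have h2 : fderiv ℝ (fun v => F v β) u = _ := h.fderiv
  simp only [pd, vpd, h2]
  rfl

theorem vpd_comp {Φ : Eu n → E} {F : Eu m → Eu n} {u : Eu m} (hΦ : DifferentiableAt ℝ Φ (F u))
    (hF : DifferentiableAt ℝ F u) (i : Fin m) :
    vpd i (fun v => Φ (F v)) u = ∑ β, tangentMap F i u β • vpd β Φ (F u) := by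
  have h : vpd i (fun v => Φ (F v)) u = fderiv ℝ Φ (F u) (vpd i F u) := by
    unfold vpd
    rw [fderiv_fun_comp u hΦ hF]; rfl
  have h2 : vpd i F u = ∑ β, tangentMap F i u β • EuclideanSpace.single β (1 : ℝ) := by
    ext γ
    simp [tangentMap, pd_coord hF, Finset.sum_apply, Pi.single_apply]
  rw [h, h2, map_sum]
  simp [vpd]

theorem vpd_comm {U : Set (Eu m)} (hU : IsOpen U) {f : Eu m → E} (hf : ContDiffOn ℝ ∞ f U)
    (i j : Fin m) {u : Eu m} (hu : u ∈ U) : vpd i (vpd j f) u = vpd j (vpd i f) u := by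
  have hs : IsSymmSndFDerivAt ℝ f u :=
    (hf.contDiffAt (hU.mem_nhds hu)).isSymmSndFDerivAt
      (by rw [minSmoothness_of_isRCLikeNormedField]; exact WithTop.coe_le_coe.2 (le_top : (2 : ℕ∞) ≤ ⊤))
  have hd : DifferentiableAt ℝ (fderiv ℝ f) u :=
    differentiableAt_of_contDiffOn hU (hf.fderiv_of_isOpen hU (by simp)) hu
  have key : ∀ i j : Fin m, vpd i (vpd j f) u =
      fderiv ℝ (fderiv ℝ f) u (EuclideanSpace.single i 1) (EuclideanSpace.single j 1) := by
    intro i j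
    have : fderiv ℝ (vpd j f) u = _ :=
      (hd.hasFDerivAt.clm_apply (hasFDerivAt_const (EuclideanSpace.single j (1 : ℝ)) u)).fderiv
    rw [vpd, this]
    simp
  rw [key, key]
  exact hs.eq _ _

theorem contDiffOn_tangentMap {U : Set (Eu m)} (hU : IsOpen U) {F : Eu m → Eu n}
    (hF : ContDiffOn ℝ ∞ F U) (j : Fin m) (α : Fin n) :
    ContDiffOn ℝ ∞ (fun u => tangentMap F j u α) U :=
  contDiffOn_pd hU ((contDiffOn_piLp 2).1 hF α) j

theorem contDiffOn_det {U : Set (Eu m)} {ι : Type*} [Fintype ι] [DecidableEq ι]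
    {A : Eu m → Matrix ι ι ℝ} (hA : ∀ i j, ContDiffOn ℝ ∞ (fun u => A u i j) U) :
    ContDiffOn ℝ ∞ (fun u => (A u).det) U := by
  simp only [Matrix.det_apply]
  exact ContDiffOn.sum fun σ _ => (contDiffOn_prod fun i _ => hA _ _).const_smul _

theorem contDiffOn_inv {U : Set (Eu m)} {ι : Type*} [Fintype ι] [DecidableEq ι]
    {A : Eu m → Matrix ι ι ℝ} (hA : ∀ i j, ContDiffOn ℝ ∞ (fun u => A u i j) U)
    (hdet : ∀ u ∈ U, (A u).det ≠ 0) (i j : ι) :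
    ContDiffOn ℝ ∞ (fun u => (A u)⁻¹ i j) U := by
  simp only [Matrix.inv_def, Ring.inverse_eq_inv', Matrix.smul_apply, smul_eq_mul,
    Matrix.adjugate_apply]
  -- Cramer's rule: each adjugate entry is the determinant of the matrix with one row replaced by a
  -- constant basis row.
  refine ((contDiffOn_det hA).inv hdet).mul (contDiffOn_det fun k l => ?_)
  by_cases h : k = j
  · subst h
    simpa using contDiffOn_const
  · simpa [Matrix.updateRow_ne h] using hA k l

end Calculus

/-! ### Parametrized patches of submanifolds of a Euclidean space -/

section Patch

variable {m n : ℕ} {E : Type*} [NormedAddCommGroup E] [InnerProductSpace ℝ E]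

/-- The immersion `f` of the open set `U` in `E` induces the metric with coefficients `g`. -/
structure IsPatch (g : Eu m → Matrix (Fin m) (Fin m) ℝ) (f : Eu m → E) (U : Set (Eu m)) :
    Prop where
  isOpen : IsOpen U
  contDiffOn : ContDiffOn ℝ ∞ f U
  metric : ∀ u ∈ U, ∀ i j, g u i j = inner ℝ (vpd i f u) (vpd j f u)
  linearIndependent : ∀ u ∈ U, LinearIndependent ℝ fun i => vpd i f u

/-- The Hessian `∇²ᵢⱼ w` of a vector-valued function for the metric `g`. -/
def hess (g : Eu m → Matrix (Fin m) (Fin m) ℝ) (w : Eu m → E) (i j : Fin m) (u : Eu m) : E :=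
  vpd i (vpd j w) u - ∑ k, christoffel g k i j u • vpd k w u

/-- The Laplacian `- tr_g ∇² w` of a vector-valued function for the metric `g`. -/
def lap (g : Eu m → Matrix (Fin m) (Fin m) ℝ) (w : Eu m → E) (u : Eu m) : E :=
  - ∑ i, ∑ j, (g u)⁻¹ i j • hess g w i j u

/-- Differentiating `⟪w, c⟫ = 0` for vector fields. -/
theorem inner_vpd_of_inner_zero {U : Set (Eu m)} (hU : IsOpen U) {w c : Eu m → E} {u : Eu m}
    (hw : DifferentiableAt ℝ w u) (hc : DifferentiableAt ℝ c u)
    (h : ∀ v ∈ U, inner ℝ (w v) (c v) = 0) (hu : u ∈ U) (i : Fin m) :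
    inner ℝ (vpd i w u) (c u) = - inner ℝ (w u) (vpd i c u) := by
  have h1 := vpd_inner hw hc i
  rw [pd_congr hU (g := fun _ => (0 : ℝ)) h i hu, pd_eq_vpd, vpd_const] at h1
  linarith

/-! ### Functions with a constant component, and affine changes of a function -/

section Constant

variable {g : Eu m → Matrix (Fin m) (Fin m) ℝ} {U : Set (Eu m)} {w : Eu m → E} {u : Eu m}

theorem inner_vpd_of_inner_const (hU : IsOpen U) (hw : ContDiffOn ℝ ∞ w U) {c : E} {ρ : ℝ}
    (h : ∀ v ∈ U, inner ℝ (w v) c = ρ) (hu : u ∈ U) (i : Fin m) : inner ℝ (vpd i w u) c = 0 := by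
  have h1 := vpd_inner (differentiableAt_of_contDiffOn hU hw hu) (differentiableAt_const (c := c)) i
  rw [pd_congr hU (g := fun _ => ρ) h i hu, pd_eq_vpd, vpd_const, vpd_const,
    inner_zero_right, add_zero] at h1
  exact h1.symm

theorem inner_lap_of_inner_const (hU : IsOpen U) (hw : ContDiffOn ℝ ∞ w U) {c : E} {ρ : ℝ}
    (h : ∀ v ∈ U, inner ℝ (w v) c = ρ) (hu : u ∈ U) : inner ℝ (lap g w u) c = 0 := by
  have h1 := fun v (hv : v ∈ U) => inner_vpd_of_inner_const hU hw h hv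
  have h2 : ∀ i j, inner ℝ (hess g w i j u) c = 0 := fun i j => by
    rw [hess, inner_sub_left, sum_inner,
      inner_vpd_of_inner_const hU (contDiffOn_vpd hU hw j) (fun v hv => h1 v hv j) hu i]
    simp [real_inner_smul_left, h1 u hu]
  simp [lap, inner_neg_left, sum_inner, real_inner_smul_left, h2]

/-- Used for `V = c f - z`, the form of the tension field in the unit sphere when `M` is minimal in
the hypersphere. -/
theorem lap_smul_sub_const (hU : IsOpen U) (hw : ContDiffOn ℝ ∞ w U) (c : ℝ) (z : E)
    (hu : u ∈ U) : lap g (fun v => c • w v - z) u = c • lap g w u := by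
  have h1 : ∀ j, Set.EqOn (vpd j fun v => c • w v - z) (fun v => c • vpd j w v) U :=
    fun j v hv => by
      have hd := differentiableAt_of_contDiffOn hU hw hv
      rw [vpd_sub (f := fun v => c • w v) (g := fun _ => z) (hd.const_smul c) (differentiableAt_const z), vpd_const_smul c hd, vpd_const,
        sub_zero]
  have h2 : ∀ i j, hess g (fun v => c • w v - z) i j u = c • hess g w i j u := fun i j => by
    simp only [hess, h1 _ hu]
    rw [vpd_congr hU (h1 j) i hu, vpd_const_smul c
      (differentiableAt_of_contDiffOn hU (contDiffOn_vpd hU hw j) hu), smul_sub, Finset.smul_sum]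
    simp only [smul_smul, mul_comm c]
  simp only [lap, h2, smul_neg, Finset.smul_sum, smul_smul, mul_comm c]

end Constant

namespace IsPatch

variable {g : Eu m → Matrix (Fin m) (Fin m) ℝ} {f : Eu m → E} {U : Set (Eu m)} {u : Eu m}

theorem mono (P : IsPatch g f U) {U' : Set (Eu m)} (hU' : IsOpen U') (h : U' ⊆ U) :
    IsPatch g f U' :=
  ⟨hU', P.contDiffOn.mono h, fun u hu => P.metric u (h hu),
    fun u hu => P.linearIndependent u (h hu)⟩

theorem differentiableAt (P : IsPatch g f U) (hu : u ∈ U) : DifferentiableAt ℝ f u :=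
  differentiableAt_of_contDiffOn P.isOpen P.contDiffOn hu

theorem contDiffOn_vpd (P : IsPatch g f U) (i : Fin m) : ContDiffOn ℝ ∞ (vpd i f) U :=
  Biharm.contDiffOn_vpd P.isOpen P.contDiffOn i

theorem differentiableAt_vpd (P : IsPatch g f U) (hu : u ∈ U) (i : Fin m) :
    DifferentiableAt ℝ (vpd i f) u :=
  differentiableAt_of_contDiffOn P.isOpen (P.contDiffOn_vpd i) hu

theorem metric_symm (P : IsPatch g f U) (hu : u ∈ U) (i j : Fin m) : g u i j = g u j i := by
  rw [P.metric u hu, P.metric u hu, real_inner_comm]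

theorem det_ne_zero (P : IsPatch g f U) (hu : u ∈ U) : (g u).det ≠ 0 := by
  have h : g u = Matrix.gram ℝ fun i => vpd i f u := by
    ext i j
    rw [P.metric u hu, Matrix.gram_apply]
  rw [h]
  exact (Matrix.posDef_gram_of_linearIndependent (P.linearIndependent u hu)).det_pos.ne'

theorem sum_inv_mul_metric (P : IsPatch g f U) (hu : u ∈ U) :
    ∑ i, ∑ j, (g u)⁻¹ i j * g u i j = m := by
  have h : ((g u)⁻¹ * g u).trace = m := by
    rw [Matrix.nonsing_inv_mul _ (P.det_ne_zero hu).isUnit]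
    simp
  rw [← h]
  simp only [Matrix.trace, Matrix.diag, Matrix.mul_apply]
  exact Finset.sum_congr rfl fun i _ => Finset.sum_congr rfl fun j _ => by
    rw [P.metric_symm hu]

theorem contDiffOn_metric (P : IsPatch g f U) (i j : Fin m) :
    ContDiffOn ℝ ∞ (fun u => g u i j) U :=
  ((P.contDiffOn_vpd i).inner ℝ (P.contDiffOn_vpd j)).congr fun u hu => P.metric u hu i j

theorem contDiffOn_inv (P : IsPatch g f U) (i j : Fin m) :
    ContDiffOn ℝ ∞ (fun u => (g u)⁻¹ i j) U :=
  Biharm.contDiffOn_inv P.contDiffOn_metric (fun _ hu => P.det_ne_zero hu) i j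

theorem contDiffOn_christoffel (P : IsPatch g f U) (k i j : Fin m) :
    ContDiffOn ℝ ∞ (christoffel g k i j) U := by
  have h := fun l i j => contDiffOn_pd P.isOpen (P.contDiffOn_metric i j) l
  exact contDiffOn_const.mul (ContDiffOn.sum fun l _ =>
    (P.contDiffOn_inv k l).mul (((h i j l).add (h j i l)).sub (h l i j)))

theorem pd_metric (P : IsPatch g f U) (hu : u ∈ U) (l i j : Fin m) :
    pd l (fun v => g v i j) u =
      inner ℝ (vpd l (vpd i f) u) (vpd j f u) + inner ℝ (vpd i f u) (vpd l (vpd j f) u) := by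
  rw [pd_congr P.isOpen (fun v hv => P.metric v hv i j) l hu,
    vpd_inner (P.differentiableAt_vpd hu i) (P.differentiableAt_vpd hu j)]

/-- With the metric coefficients written as `⟪∂ᵢf, ∂ⱼf⟫`, symmetry of second derivatives makes four
of the six terms in the Christoffel symbol cancel and the other two coincide. -/
theorem sum_christoffel_mul_metric (P : IsPatch g f U) (hu : u ∈ U) (i j l : Fin m) :
    ∑ k, christoffel g k i j u * g u k l = inner ℝ (vpd i (vpd j f) u) (vpd l f u) := by
  have h1 : (fun k => christoffel g k i j u) = (g u)⁻¹.mulVec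
      (fun l => inner ℝ (vpd i (vpd j f) u) (vpd l f u)) := by
    ext k
    simp only [christoffel, Matrix.mulVec, dotProduct, Finset.mul_sum]
    refine Finset.sum_congr rfl fun l _ => ?_
    rw [P.pd_metric hu, P.pd_metric hu, P.pd_metric hu, vpd_comm P.isOpen P.contDiffOn j i hu,
      vpd_comm P.isOpen P.contDiffOn l i hu, vpd_comm P.isOpen P.contDiffOn l j hu,
      real_inner_comm (vpd j f u)]
    ring
  have h2 := congrFun (congrArg (g u).mulVec h1) l
  rw [Matrix.mulVec_mulVec, Matrix.mul_nonsing_inv _ (P.det_ne_zero hu).isUnit,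
    Matrix.one_mulVec] at h2
  rw [← h2]
  simp only [Matrix.mulVec, dotProduct]
  exact Finset.sum_congr rfl fun k _ => by rw [P.metric_symm hu, mul_comm]

/-- The Christoffel terms remove exactly the tangential part of `∂ᵢ∂ⱼf`; the Hessian of the
immersion is its second fundamental form. -/
theorem inner_hess (P : IsPatch g f U) (hu : u ∈ U) (i j l : Fin m) :
    inner ℝ (hess g f i j u) (vpd l f u) = 0 := by
  rw [hess, inner_sub_left, sum_inner, ← P.sum_christoffel_mul_metric hu, sub_eq_zero]
  exact Finset.sum_congr rfl fun k _ => by rw [real_inner_smul_left, P.metric u hu]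

theorem inner_lap (P : IsPatch g f U) (hu : u ∈ U) (l : Fin m) :
    inner ℝ (lap g f u) (vpd l f u) = 0 := by
  simp [lap, inner_neg_left, sum_inner, real_inner_smul_left, P.inner_hess hu]

theorem inner_vpd_self (P : IsPatch g f U) {ρ : ℝ}
    (h : ∀ v ∈ U, inner ℝ (f v) (f v) = ρ) (hu : u ∈ U) (i : Fin m) :
    inner ℝ (vpd i f u) (f u) = 0 := by
  have h1 := vpd_inner (P.differentiableAt hu) (P.differentiableAt hu) i
  rw [pd_congr P.isOpen (g := fun _ => ρ) h i hu, pd_eq_vpd, vpd_const,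
    real_inner_comm (vpd i f u)] at h1
  linarith

theorem inner_hess_self (P : IsPatch g f U) {ρ : ℝ}
    (h : ∀ v ∈ U, inner ℝ (f v) (f v) = ρ) (hu : u ∈ U) (i j : Fin m) :
    inner ℝ (hess g f i j u) (f u) = - g u i j := by
  rw [hess, inner_sub_left, sum_inner, inner_vpd_of_inner_zero P.isOpen
    (P.differentiableAt_vpd hu j) (P.differentiableAt hu)
    (fun v hv => P.inner_vpd_self h hv j) hu i, P.metric_symm hu, P.metric u hu]
  simp [real_inner_smul_left, P.inner_vpd_self h hu]

/-- Differentiating `|f|² = ρ` twice gives `⟪∇²f, f⟫ = -g`, whose trace is `-m`. -/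
theorem inner_lap_self (P : IsPatch g f U) {ρ : ℝ}
    (h : ∀ v ∈ U, inner ℝ (f v) (f v) = ρ) (hu : u ∈ U) : inner ℝ (lap g f u) (f u) = m := by
  simp [lap, inner_neg_left, sum_inner, real_inner_smul_left, P.inner_hess_self h hu,
    P.sum_inv_mul_metric hu]

end IsPatch

/-- A vector orthogonal to a maximal family of independent vectors, split into two mutually
orthogonal families, vanishes. -/
theorem eq_zero_of_inner_eq_zero [FiniteDimensional ℝ E] {ι κ : Type*} [Fintype ι] [Fintype κ]
    {v : ι → E} {w : κ → E} (hv : LinearIndependent ℝ v) (hw : LinearIndependent ℝ w)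
    (hvw : ∀ i k, inner ℝ (v i) (w k) = 0)
    (hcard : Fintype.card ι + Fintype.card κ = Module.finrank ℝ E) {x : E}
    (hxv : ∀ i, inner ℝ x (v i) = 0) (hxw : ∀ k, inner ℝ x (w k) = 0) : x = 0 := by
  have ho : Submodule.span ℝ (Set.range v) ⟂ Submodule.span ℝ (Set.range w) := by
    rw [Submodule.isOrtho_span]
    rintro _ ⟨i, rfl⟩ _ ⟨k, rfl⟩
    exact hvw i k
  have hl := hv.sum_type hw ho.disjoint
  have ht := hl.span_eq_top_of_card_eq_finrank' (by rw [Fintype.card_sum, hcard])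
  have hx : ∀ y ∈ Submodule.span ℝ (Set.range (Sum.elim v w)), inner ℝ x y = 0 := by
    intro y hy
    induction hy using Submodule.span_induction with
    | mem y hy =>
      obtain ⟨i | k, rfl⟩ := hy
      · exact hxv i
      · exact hxw k
    | zero => simp
    | add y z _ _ hy hz => rw [inner_add_right, hy, hz, add_zero]
    | smul c y _ hy => rw [real_inner_smul_right, hy, mul_zero]
  exact inner_self_eq_zero.1 (hx x (ht ▸ Submodule.mem_top))

end Patch

/-! ### Maps into a patch -/

section PatchMap

variable {m n : ℕ} {E : Type*} [NormedAddCommGroup E] [InnerProductSpace ℝ E]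

/-- The vector `xᵅ ∂_α Φ (y)` with components `x` in the parametrization `Φ`. -/
def push (Φ : Eu n → E) (y : Eu n) : (Fin n → ℝ) →ₗ[ℝ] E :=
  Fintype.linearCombination ℝ fun α => vpd α Φ y

theorem push_apply (Φ : Eu n → E) (y : Eu n) (x : Fin n → ℝ) :
    push Φ y x = ∑ α, x α • vpd α Φ y := by
  simp [push, Fintype.linearCombination_apply]

theorem IsPatch.inner_push {h : Eu n → Matrix (Fin n) (Fin n) ℝ} {Φ : Eu n → E} {Y : Set (Eu n)}
    (Q : IsPatch h Φ Y) {y : Eu n} (hy : y ∈ Y) (x z : Fin n → ℝ) :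
    inner ℝ (push Φ y x) (push Φ y z) = ∑ α, ∑ β, x α * z β * h y α β := by
  simp only [push_apply, sum_inner, inner_sum, real_inner_smul_left, real_inner_smul_right,
    ← Q.metric y hy]
  rw [Finset.sum_comm]
  exact Finset.sum_congr rfl fun α _ => Finset.sum_congr rfl fun β _ => by ring

theorem IsPatch.push_injective {h : Eu n → Matrix (Fin n) (Fin n) ℝ} {Φ : Eu n → E}
    {Y : Set (Eu n)} (Q : IsPatch h Φ Y) {y : Eu n} (hy : y ∈ Y) :
    Function.Injective (push Φ y) :=
  (Q.linearIndependent y hy).fintypeLinearCombination_injective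

/-- A tangent vector orthogonal to the whole tangent frame is orthogonal to itself. -/
theorem eq_zero_of_inner_push_eq_zero {h : Eu n → Matrix (Fin n) (Fin n) ℝ} {Φ : Eu n → E}
    {Y : Set (Eu n)} (Q : IsPatch h Φ Y) {y : Eu n} (hy : y ∈ Y) {x : Fin n → ℝ}
    (hx : ∀ β, inner ℝ (push Φ y x) (vpd β Φ y) = 0) : x = 0 := by
  apply Q.push_injective hy
  rw [map_zero, ← inner_self_eq_zero (𝕜 := ℝ)]
  nth_rw 2 [push_apply]
  simp [inner_sum, real_inner_smul_right, hx]

/-- The map `F` into the patch `Φ`, whose composition with `Φ` is the patch `f`. -/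
structure IsPatchMap (g : Eu m → Matrix (Fin m) (Fin m) ℝ) (f : Eu m → E) (U : Set (Eu m))
    (h : Eu n → Matrix (Fin n) (Fin n) ℝ) (Φ : Eu n → E) (Y : Set (Eu n)) (F : Eu m → Eu n) :
    Prop where
  source : IsPatch g f U
  target : IsPatch h Φ Y
  contDiffOn : ContDiffOn ℝ ∞ F U
  mapsTo : Set.MapsTo F U Y
  comp : ∀ u ∈ U, f u = Φ (F u)

/-- Pushing forward at a fixed point is linear, so it passes through the traces; no derivative of
`Φ` is taken here. -/
theorem push_divergence (g : Eu m → Matrix (Fin m) (Fin m) ℝ)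
    (h : Eu n → Matrix (Fin n) (Fin n) ℝ) (Φ : Eu n → E) (F : Eu m → Eu n)
    (θ : Fin m → Eu m → Fin n → ℝ) (u : Eu m) :
    push Φ (F u) (divergence g h F θ u) = - ∑ i, ∑ j, (g u)⁻¹ i j •
      (push Φ (F u) (pullbackNabla h F i (θ j) u) -
        ∑ k, christoffel g k i j u • push Φ (F u) (θ k u)) := by
  have h1 : divergence g h F θ u = - ∑ i, ∑ j, (g u)⁻¹ i j •
      (pullbackNabla h F i (θ j) u - ∑ k, christoffel g k i j u • θ k u) := by
    ext α
    simp [divergence, Finset.sum_apply]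
  rw [h1]
  simp only [map_neg, map_sum, map_smul, map_sub]

namespace IsPatchMap

variable {g : Eu m → Matrix (Fin m) (Fin m) ℝ} {f : Eu m → E} {U : Set (Eu m)}
    {h : Eu n → Matrix (Fin n) (Fin n) ℝ} {Φ : Eu n → E} {Y : Set (Eu n)} {F : Eu m → Eu n}
    {u : Eu m}

theorem mono (S : IsPatchMap g f U h Φ Y F) {U' : Set (Eu m)} (hU' : IsOpen U') (hs : U' ⊆ U) :
    IsPatchMap g f U' h Φ Y F :=
  ⟨S.source.mono hU' hs, S.target, S.contDiffOn.mono hs, S.mapsTo.mono_left hs,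
    fun u hu => S.comp u (hs hu)⟩

theorem isOpen (S : IsPatchMap g f U h Φ Y F) : IsOpen U := S.source.isOpen

theorem differentiableAt (S : IsPatchMap g f U h Φ Y F) (hu : u ∈ U) : DifferentiableAt ℝ F u :=
  differentiableAt_of_contDiffOn S.isOpen S.contDiffOn hu

theorem push_tangentMap (S : IsPatchMap g f U h Φ Y F) (hu : u ∈ U) (j : Fin m) :
    push Φ (F u) (tangentMap F j u) = vpd j f u := by
  rw [vpd_congr S.isOpen (g := fun v => Φ (F v)) S.comp j hu,
    vpd_comp (S.target.differentiableAt (S.mapsTo hu)) (S.differentiableAt hu), push_apply]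

theorem contDiffOn_pullbackNabla (S : IsPatchMap g f U h Φ Y F) {V : Eu m → Fin n → ℝ}
    (hV : ∀ α, ContDiffOn ℝ ∞ (fun v => V v α) U) (i : Fin m) (α : Fin n) :
    ContDiffOn ℝ ∞ (fun v => pullbackNabla h F i V v α) U :=
  (contDiffOn_pd S.isOpen (hV α) i).add <| ContDiffOn.sum fun β _ => ContDiffOn.sum fun γ _ =>
    (((S.target.contDiffOn_christoffel α β γ).comp S.contDiffOn S.mapsTo).mul
      (contDiffOn_tangentMap S.isOpen S.contDiffOn i β)).mul (hV γ)

theorem contDiffOn_divergence (S : IsPatchMap g f U h Φ Y F) {θ : Fin m → Eu m → Fin n → ℝ}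
    (hθ : ∀ j α, ContDiffOn ℝ ∞ (fun v => θ j v α) U) (α : Fin n) :
    ContDiffOn ℝ ∞ (fun v => divergence g h F θ v α) U :=
  ContDiffOn.neg <| ContDiffOn.sum fun i _ => ContDiffOn.sum fun j _ =>
    (S.source.contDiffOn_inv i j).mul <| (S.contDiffOn_pullbackNabla (hθ j) i α).sub <|
      ContDiffOn.sum fun k _ => (S.source.contDiffOn_christoffel k i j).mul (hθ k α)

theorem contDiffOn_deltaT (S : IsPatchMap g f U h Φ Y F) (α : Fin n) :
    ContDiffOn ℝ ∞ (fun v => deltaT g h F v α) U :=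
  S.contDiffOn_divergence (fun j => contDiffOn_tangentMap S.isOpen S.contDiffOn j) α

theorem contDiffOn_push (S : IsPatchMap g f U h Φ Y F) {V : Eu m → Fin n → ℝ}
    (hV : ∀ α, ContDiffOn ℝ ∞ (fun v => V v α) U) :
    ContDiffOn ℝ ∞ (fun v => push Φ (F v) (V v)) U := by
  simp only [push_apply]
  exact ContDiffOn.sum fun α _ =>
    (hV α).smul ((S.target.contDiffOn_vpd α).comp S.contDiffOn S.mapsTo)

/-- The Gauss formula for the pulled back connection. -/
theorem push_pullbackNabla (S : IsPatchMap g f U h Φ Y F) {V : Eu m → Fin n → ℝ}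
    (hV : ∀ α, ContDiffOn ℝ ∞ (fun v => V v α) U) (hu : u ∈ U) (i : Fin m) :
    push Φ (F u) (pullbackNabla h F i V u) = vpd i (fun v => push Φ (F v) (V v)) u -
      ∑ β, ∑ γ, (tangentMap F i u β * V u γ) • hess h Φ β γ (F u) := by
  have hd : ∀ γ, DifferentiableAt ℝ (fun v => vpd γ Φ (F v)) u := fun γ =>
    (S.target.differentiableAt_vpd (S.mapsTo hu) γ).comp u (S.differentiableAt hu)
  have hVd : ∀ α, DifferentiableAt ℝ (fun v => V v α) u := fun α =>
    differentiableAt_of_contDiffOn S.isOpen (hV α) hu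
  have h1 : vpd i (fun v => push Φ (F v) (V v)) u = ∑ γ, (pd i (fun v => V v γ) u • vpd γ Φ (F u)
      + ∑ β, (tangentMap F i u β * V u γ) • vpd β (vpd γ Φ) (F u)) := by
    simp only [push_apply]
    rw [vpd_sum (f := fun γ v => V v γ • vpd γ Φ (F v)) _ fun γ _ => (hVd γ).smul (hd γ)]
    refine Finset.sum_congr rfl fun γ _ => ?_
    rw [vpd_smul (hVd γ) (hd γ), vpd_comp (S.target.differentiableAt_vpd (S.mapsTo hu) γ)
      (S.differentiableAt hu), Finset.smul_sum]
    simp only [smul_smul, mul_comm]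
  have h2 : push Φ (F u) (pullbackNabla h F i V u) = ∑ γ, pd i (fun v => V v γ) u • vpd γ Φ (F u)
      + ∑ β, ∑ γ, (tangentMap F i u β * V u γ) •
        ∑ α, christoffel h α β γ (F u) • vpd α Φ (F u) := by
    simp only [push_apply, pullbackNabla, add_smul, Finset.sum_add_distrib, Finset.sum_smul,
      Finset.smul_sum, smul_smul]
    congr 1
    rw [Finset.sum_comm]
    refine Finset.sum_congr rfl fun β _ => ?_
    rw [Finset.sum_comm]
    refine Finset.sum_congr rfl fun γ _ => Finset.sum_congr rfl fun α _ => ?_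
    congr 1
    ring
  rw [h1, h2, Finset.sum_add_distrib, Finset.sum_comm (f := fun γ β =>
    (tangentMap F i u β * V u γ) • vpd β (vpd γ Φ) (F u))]
  simp only [hess, smul_sub, Finset.sum_sub_distrib]
  abel

theorem push_deltaT (S : IsPatchMap g f U h Φ Y F) (hu : u ∈ U) :
    push Φ (F u) (deltaT g h F u) = lap g f u + ∑ i, ∑ j, (g u)⁻¹ i j •
      ∑ β, ∑ γ, (tangentMap F i u β * tangentMap F j u γ) • hess h Φ β γ (F u) := by
  have h1 : ∀ i j, push Φ (F u) (pullbackNabla h F i (tangentMap F j) u) =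
      vpd i (vpd j f) u -
        ∑ β, ∑ γ, (tangentMap F i u β * tangentMap F j u γ) • hess h Φ β γ (F u) := fun i j => by
    rw [S.push_pullbackNabla (contDiffOn_tangentMap S.isOpen S.contDiffOn j) hu,
      vpd_congr S.isOpen (fun v hv => S.push_tangentMap hv j) i hu]
  simp only [deltaT, push_divergence, h1, S.push_tangentMap hu, lap, hess, smul_sub,
    Finset.sum_sub_distrib]
  abel

/-- By `push_deltaT`, the pushed section differs from `lap g f` by second fundamental forms of the
target, which are normal to it. Only the tangential part of `lap g f` is seen. -/
theorem deltaT_eq_zero_iff (S : IsPatchMap g f U h Φ Y F) (hu : u ∈ U) :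
    deltaT g h F u = 0 ↔ ∀ β, inner ℝ (lap g f u) (vpd β Φ (F u)) = 0 := by
  have key : ∀ β, inner ℝ (push Φ (F u) (deltaT g h F u)) (vpd β Φ (F u)) =
      inner ℝ (lap g f u) (vpd β Φ (F u)) := fun β => by
    simp [S.push_deltaT hu, inner_add_left, sum_inner, real_inner_smul_left,
      S.target.inner_hess (S.mapsTo hu)]
  refine ⟨fun h0 β => ?_, fun h0 => ?_⟩
  · rw [← key, h0, map_zero, inner_zero_left]
  · exact eq_zero_of_inner_push_eq_zero S.target (S.mapsTo hu) fun β => (key β).trans (h0 β)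

end IsPatchMap

/-! ### Maps into a hypersphere of codimension two -/

/-- The target has codimension two and its normal plane is spanned by the orthogonal vectors `f - b
e`, of squared length `a²`, and `e`. The components of `lap g f` along both are known in advance, so
vanishing of the tangential part determines it. -/
theorem IsPatchMap.deltaT_eq_zero_iff_lap_eq [FiniteDimensional ℝ E]
    {g : Eu m → Matrix (Fin m) (Fin m) ℝ} {f : Eu m → E} {U : Set (Eu m)}
    {h : Eu n → Matrix (Fin n) (Fin n) ℝ} {Φ : Eu n → E} {Y : Set (Eu n)} {F : Eu m → Eu n}
    (S : IsPatchMap g f U h Φ Y F) (hdim : n + 2 = Module.finrank ℝ E) {e : E} {a b : ℝ}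
    (he : inner ℝ e e = (1 : ℝ)) (ha : a ≠ 0) (hab : b ^ 2 = 1 - a ^ 2)
    (hΦ : ∀ y ∈ Y, inner ℝ (Φ y) (Φ y) = (1 : ℝ)) (hΦe : ∀ y ∈ Y, inner ℝ (Φ y) e = b)
    {u : Eu m} (hu : u ∈ U) :
    deltaT g h F u = 0 ↔ lap g f u = (m / a ^ 2 : ℝ) • (f u - b • e) := by
  have hy := S.mapsTo hu
  have hf : ∀ v ∈ U, inner ℝ (f v) (f v) = (1 : ℝ) := fun v hv => by
    rw [S.comp v hv, hΦ _ (S.mapsTo hv)]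
  have hfe : ∀ v ∈ U, inner ℝ (f v) e = b := fun v hv => by
    rw [S.comp v hv, hΦe _ (S.mapsTo hv)]
  have ho : ∀ β, inner ℝ (f u - b • e) (vpd β Φ (F u)) = 0 := fun β => by
    rw [S.comp u hu, inner_sub_left, real_inner_smul_left, real_inner_comm,
      S.target.inner_vpd_self hΦ hy, real_inner_comm, inner_vpd_of_inner_const S.target.isOpen S.target.contDiffOn hΦe hy]
    simp
  have hne : inner ℝ (f u - b • e) e = (0 : ℝ) := by
    rw [inner_sub_left, real_inner_smul_left, hfe u hu, he]
    ring
  have hnn : inner ℝ (f u - b • e) (f u - b • e) = a ^ 2 := by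
    rw [inner_sub_right, real_inner_smul_right, hne, inner_sub_left, real_inner_smul_left,
      hf u hu, real_inner_comm, hfe u hu]
    linarith
  rw [S.deltaT_eq_zero_iff hu]
  refine ⟨fun h0 => ?_, fun h0 β => by rw [h0, real_inner_smul_left, ho, mul_zero]⟩
  rw [← sub_eq_zero]
  have hw : LinearIndependent ℝ ![f u - b • e, e] := by
    apply linearIndependent_of_ne_zero_of_inner_eq_zero (𝕜 := ℝ)
    · intro k
      fin_cases k
      · intro h1
        simp only [Fin.zero_eta, Matrix.cons_val_zero] at h1
        rw [h1, inner_zero_left] at hnn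
        exact ha (pow_eq_zero_iff two_ne_zero |>.1 hnn.symm)
      · intro h1
        simp only [Fin.mk_one, Matrix.cons_val_one, Matrix.cons_val_fin_one] at h1
        rw [h1, inner_zero_left] at he
        exact zero_ne_one he
    · intro k l hkl
      fin_cases k <;> fin_cases l <;> simp_all [real_inner_comm]
  have hTe := inner_lap_of_inner_const (g := g) S.isOpen S.source.contDiffOn hfe hu
  -- The difference of the two sides is tested against the tangent frame of the target and the two
  -- normal vectors, which together form a basis of `E`.
  refine eq_zero_of_inner_eq_zero (S.target.linearIndependent _ hy) hw ?_ (by simpa using hdim)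
    (fun β => by rw [inner_sub_left, h0, real_inner_smul_left, ho]; simp) ?_
  · intro β k
    fin_cases k
    · simpa [real_inner_comm] using ho β
    · simpa using inner_vpd_of_inner_const S.target.isOpen S.target.contDiffOn hΦe hy β
  · intro k
    fin_cases k
    · simp only [Fin.zero_eta, Matrix.cons_val_zero]
      rw [inner_sub_left, real_inner_smul_left, hnn, inner_sub_right, real_inner_smul_right,
        hTe, S.source.inner_lap_self hf hu]
      field_simp
      ring
    · simp only [Fin.mk_one, Matrix.cons_val_one, Matrix.cons_val_fin_one]
      rw [inner_sub_left, real_inner_smul_left, hne, hTe]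
      simp

/-! ### Maps into a sphere -/

/-- In codimension one the second fundamental form is a multiple of the unit normal `Φ`, and
`inner_hess_self` gives the multiple. -/
theorem IsPatch.hess_eq_of_sphere [FiniteDimensional ℝ E]
    {h : Eu n → Matrix (Fin n) (Fin n) ℝ} {Φ : Eu n → E} {Y : Set (Eu n)} (Q : IsPatch h Φ Y)
    (hdim : n + 1 = Module.finrank ℝ E) (hΦ : ∀ y ∈ Y, inner ℝ (Φ y) (Φ y) = (1 : ℝ))
    {y : Eu n} (hy : y ∈ Y) (α β : Fin n) : hess h Φ α β y = - (h y α β • Φ y) := by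
  rw [← sub_eq_zero, sub_neg_eq_add]
  have hw : LinearIndependent ℝ fun _ : Fin 1 => Φ y := by
    rw [linearIndependent_unique_iff]
    intro h0
    have := hΦ y hy
    rw [h0, inner_zero_left] at this
    exact zero_ne_one this
  refine eq_zero_of_inner_eq_zero (Q.linearIndependent _ hy) hw
    (fun β _ => Q.inner_vpd_self hΦ hy β) (by simpa using hdim) (fun γ => ?_) fun _ => ?_
  · rw [inner_add_left, Q.inner_hess hy, real_inner_smul_left, real_inner_comm,
      Q.inner_vpd_self hΦ hy]
    simp
  · rw [inner_add_left, Q.inner_hess_self hΦ hy, real_inner_smul_left, hΦ y hy]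
    ring

/-- The Gauss equation: the unit sphere has constant curvature one. -/
theorem IsPatch.push_curvature [FiniteDimensional ℝ E]
    {h : Eu n → Matrix (Fin n) (Fin n) ℝ} {Φ : Eu n → E} {Y : Set (Eu n)} (Q : IsPatch h Φ Y)
    (hdim : n + 1 = Module.finrank ℝ E) (hΦ : ∀ y ∈ Y, inner ℝ (Φ y) (Φ y) = (1 : ℝ))
    {y : Eu n} (hy : y ∈ Y) (β γ δ : Fin n) :
    push Φ y (fun α => curvature h α β γ δ y) =
      h y δ β • vpd γ Φ y - h y γ β • vpd δ Φ y := by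
  have h2 : ∀ γ δ, ∀ v ∈ Y, vpd γ (vpd δ Φ) v =
      ∑ α, christoffel h α γ δ v • vpd α Φ v - h v γ δ • Φ v := fun γ δ v hv => by
    have := Q.hess_eq_of_sphere hdim hΦ hv γ δ
    rw [hess, sub_eq_iff_eq_add] at this
    rw [this]
    abel
  have hΓ : ∀ α γ δ, DifferentiableAt ℝ (christoffel h α γ δ) y := fun α γ δ =>
    differentiableAt_of_contDiffOn Q.isOpen (Q.contDiffOn_christoffel α γ δ) hy
  have hh : ∀ γ δ, DifferentiableAt ℝ (fun v => h v γ δ) y := fun γ δ =>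
    differentiableAt_of_contDiffOn Q.isOpen (Q.contDiffOn_metric γ δ) hy
  -- Differentiating the Gauss formula once more. Only the tangential part matters, so the
  -- coefficient of `Φ` is kept as an unspecified `s`.
  have h3 : ∀ γ δ, ∃ s : ℝ, vpd γ (vpd δ (vpd β Φ)) y =
      ∑ α, (pd γ (christoffel h α δ β) y +
        ∑ ε, christoffel h α γ ε y * christoffel h ε δ β y) • vpd α Φ y -
        h y δ β • vpd γ Φ y + s • Φ y := fun γ δ => by
    refine ⟨- pd γ (fun v => h v δ β) y - ∑ α, christoffel h α δ β y * h y γ α, ?_⟩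
    rw [vpd_congr Q.isOpen (h2 δ β) γ hy, vpd_sub
      (f := fun v => ∑ α, christoffel h α δ β v • vpd α Φ v) (g := fun v => h v δ β • Φ v)
      (DifferentiableAt.fun_sum fun α _ => (hΓ α δ β).smul (Q.differentiableAt_vpd hy α))
      ((hh δ β).smul (Q.differentiableAt hy)),
      vpd_sum (f := fun α v => christoffel h α δ β v • vpd α Φ v) _ fun α _ => (hΓ α δ β).smul (Q.differentiableAt_vpd hy α),
      vpd_smul (hh δ β) (Q.differentiableAt hy)]
    have h4 : ∀ α, vpd γ (fun v => christoffel h α δ β v • vpd α Φ v) y =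
        pd γ (christoffel h α δ β) y • vpd α Φ y +
        (∑ ε, (christoffel h ε γ α y * christoffel h α δ β y) • vpd ε Φ y -
          (christoffel h α δ β y * h y γ α) • Φ y) := fun α => by
      rw [vpd_smul (hΓ α δ β) (Q.differentiableAt_vpd hy α), h2 γ α y hy, smul_sub,
        Finset.smul_sum]
      simp only [smul_smul, mul_comm]
    simp only [h4, add_smul, Finset.sum_add_distrib, Finset.sum_sub_distrib, Finset.sum_smul,
      sub_smul, neg_smul]
    rw [Finset.sum_comm (f := fun α ε =>
      (christoffel h ε γ α y * christoffel h α δ β y) • vpd ε Φ y)]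
    abel
  obtain ⟨s, hs⟩ := h3 γ δ
  obtain ⟨t, ht⟩ := h3 δ γ
  -- Third derivatives commute; antisymmetrizing in `γ, δ` makes the curvature appear.
  rw [vpd_comm Q.isOpen (Q.contDiffOn_vpd β) γ δ hy, ht] at hs
  have h5 : push Φ y (fun α => curvature h α β γ δ y) -
      (h y δ β • vpd γ Φ y - h y γ β • vpd δ Φ y) = (t - s) • Φ y := by
    rw [push_apply]
    simp only [curvature, add_smul, sub_smul, Finset.sum_add_distrib, Finset.sum_sub_distrib]
      at hs ⊢
    rw [← sub_eq_zero] at hs ⊢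
    rw [← neg_eq_zero, ← hs]
    abel
  -- The left side of `h5` is tangent and the right side is normal, so pairing with `Φ` kills the
  -- coefficient.
  have h6 : t - s = 0 := by
    have := congrArg (inner ℝ · (Φ y)) h5
    simp only [push_apply, inner_sub_left, sum_inner, real_inner_smul_left,
      Q.inner_vpd_self hΦ hy, hΦ y hy, mul_zero, Finset.sum_const_zero, sub_zero] at this
    linarith
  rw [h6, zero_smul, sub_eq_zero] at h5
  exact h5

end PatchMap

/-! ### The biharmonic equation in the unit sphere, in ambient terms -/

namespace IsPatchMap

variable {m n : ℕ} {E : Type*} [NormedAddCommGroup E] [InnerProductSpace ℝ E]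
  {g : Eu m → Matrix (Fin m) (Fin m) ℝ} {f : Eu m → E} {U : Set (Eu m)}
  {h : Eu n → Matrix (Fin n) (Fin n) ℝ} {Φ : Eu n → E} {Y : Set (Eu n)} {F : Eu m → Eu n}
  {u : Eu m}

theorem inner_vpd_push (S : IsPatchMap g f U h Φ Y F) (hu : u ∈ U) (i : Fin m)
    (x : Fin n → ℝ) : inner ℝ (vpd i f u) (push Φ (F u) x) =
      ∑ β, ∑ γ, tangentMap F i u β * x γ * h (F u) β γ := by
  rw [← S.push_tangentMap hu, S.target.inner_push (S.mapsTo hu)]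

theorem inner_source_self (S : IsPatchMap g f U h Φ Y F)
    (hΦ : ∀ y ∈ Y, inner ℝ (Φ y) (Φ y) = (1 : ℝ)) (v : Eu m) (hv : v ∈ U) :
    inner ℝ (f v) (f v) = (1 : ℝ) := by
  rw [S.comp v hv, hΦ _ (S.mapsTo hv)]

variable [FiniteDimensional ℝ E]

theorem sum_smul_hess_of_sphere (S : IsPatchMap g f U h Φ Y F)
    (hdim : n + 1 = Module.finrank ℝ E) (hΦ : ∀ y ∈ Y, inner ℝ (Φ y) (Φ y) = (1 : ℝ))
    (hu : u ∈ U) (i : Fin m) (x : Fin n → ℝ) :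
    ∑ β, ∑ γ, (tangentMap F i u β * x γ) • hess h Φ β γ (F u) =
      - ((inner ℝ (vpd i f u) (push Φ (F u) x) : ℝ) • f u) := by
  simp only [S.inner_vpd_push hu, S.target.hess_eq_of_sphere hdim hΦ (S.mapsTo hu),
    ← S.comp u hu, smul_neg, Finset.sum_neg_distrib, Finset.sum_smul, smul_smul]

/-- The second fundamental form of the sphere is `-h Φ`, and its trace along `M` is `-m f`. -/
theorem push_deltaT_of_sphere (S : IsPatchMap g f U h Φ Y F)
    (hdim : n + 1 = Module.finrank ℝ E) (hΦ : ∀ y ∈ Y, inner ℝ (Φ y) (Φ y) = (1 : ℝ))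
    (hu : u ∈ U) : push Φ (F u) (deltaT g h F u) = lap g f u - (m : ℝ) • f u := by
  rw [S.push_deltaT hu, sub_eq_add_neg]
  congr 1
  simp only [S.sum_smul_hess_of_sphere hdim hΦ hu, S.push_tangentMap hu, ← S.source.metric u hu,
    smul_neg, Finset.sum_neg_distrib, smul_smul, ← Finset.sum_smul, S.source.sum_inv_mul_metric hu]

/-- Constant curvature one gives `R_{X,Z}Z = |Z|² X - ⟪X, Z⟫ Z`. The second term vanishes for `X`
normal to `M`, and the trace of the first is `m X`. -/
theorem push_curvatureTrace_of_sphere (S : IsPatchMap g f U h Φ Y F)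
    (hdim : n + 1 = Module.finrank ℝ E) (hΦ : ∀ y ∈ Y, inner ℝ (Φ y) (Φ y) = (1 : ℝ))
    (hu : u ∈ U) {X : Eu m → Fin n → ℝ}
    (hX : ∀ j, inner ℝ (vpd j f u) (push Φ (F u) (X u)) = (0 : ℝ)) :
    push Φ (F u) (curvatureTrace g h F X u) = (m : ℝ) • push Φ (F u) (X u) := by
  have h1 : curvatureTrace g h F X u = ∑ i, ∑ j, (g u)⁻¹ i j • ∑ β, ∑ γ, ∑ δ,
      (X u γ * tangentMap F i u δ * tangentMap F j u β) •
        fun α => curvature h α β γ δ (F u) := by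
    ext α
    simp only [curvatureTrace, Finset.sum_apply, Pi.smul_apply, smul_eq_mul]
    refine Finset.sum_congr rfl fun i _ => Finset.sum_congr rfl fun j _ => ?_
    congr 1
    refine Finset.sum_congr rfl fun β _ => Finset.sum_congr rfl fun γ _ =>
      Finset.sum_congr rfl fun δ _ => by ring
  have h2 : ∀ i j, ∑ β, ∑ γ, ∑ δ, (X u γ * tangentMap F i u δ * tangentMap F j u β) •
      (h (F u) δ β • vpd γ Φ (F u) - h (F u) γ β • vpd δ Φ (F u)) =
      g u i j • push Φ (F u) (X u) := fun i j => by
    have h3 : ∑ β, ∑ γ, ∑ δ, (X u γ * tangentMap F i u δ * tangentMap F j u β) •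
        (h (F u) δ β • vpd γ Φ (F u)) = g u i j • push Φ (F u) (X u) := by
      rw [S.source.metric u hu, ← S.push_tangentMap hu j, S.inner_vpd_push hu, push_apply,
        Finset.smul_sum, Finset.sum_comm]
      refine Finset.sum_congr rfl fun γ _ => ?_
      rw [Finset.sum_smul, Finset.sum_comm]
      refine Finset.sum_congr rfl fun δ _ => ?_
      rw [Finset.sum_smul]
      refine Finset.sum_congr rfl fun β _ => ?_
      rw [smul_smul, smul_smul]
      congr 1
      ring
    have h4 : ∑ β, ∑ γ, ∑ δ, (X u γ * tangentMap F i u δ * tangentMap F j u β) •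
        (h (F u) γ β • vpd δ Φ (F u)) = 0 := by
      have h5 : ∑ β, ∑ γ, ∑ δ, (X u γ * tangentMap F i u δ * tangentMap F j u β) •
          (h (F u) γ β • vpd δ Φ (F u)) =
          (inner ℝ (vpd j f u) (push Φ (F u) (X u)) : ℝ) • vpd i f u := by
        rw [← S.push_tangentMap hu i, S.inner_vpd_push hu, push_apply, Finset.sum_smul]
        refine Finset.sum_congr rfl fun β _ => ?_
        rw [Finset.sum_smul]
        refine Finset.sum_congr rfl fun γ _ => ?_
        rw [Finset.smul_sum]
        refine Finset.sum_congr rfl fun δ _ => ?_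
        rw [smul_smul, smul_smul, S.target.metric_symm (S.mapsTo hu) γ β]
        congr 1
        ring
      rw [h5, hX, zero_smul]
    simp only [smul_sub, Finset.sum_sub_distrib]
    rw [h3, h4, sub_zero]
  rw [h1]
  simp only [map_sum, map_smul, S.target.push_curvature hdim hΦ (S.mapsTo hu), h2, smul_smul,
    ← Finset.sum_smul, S.source.sum_inv_mul_metric hu]

theorem contDiffOn_tension (S : IsPatchMap g f U h Φ Y F)
    (hdim : n + 1 = Module.finrank ℝ E) (hΦ : ∀ y ∈ Y, inner ℝ (Φ y) (Φ y) = (1 : ℝ)) :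
    ContDiffOn ℝ ∞ (fun v => lap g f v - (m : ℝ) • f v) U :=
  (S.contDiffOn_push S.contDiffOn_deltaT).congr fun _ hv =>
    (S.push_deltaT_of_sphere hdim hΦ hv).symm

/-- The rough Laplacian of the tension field of a map into the unit sphere. -/
theorem push_roughLaplacian_deltaT_of_sphere (S : IsPatchMap g f U h Φ Y F)
    (hdim : n + 1 = Module.finrank ℝ E) (hΦ : ∀ y ∈ Y, inner ℝ (Φ y) (Φ y) = (1 : ℝ))
    {V : Eu m → E} (hV : ∀ v ∈ U, V v = lap g f v - (m : ℝ) • f v) (hu : u ∈ U) :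
    push Φ (F u) (roughLaplacian g h F (deltaT g h F) u) =
      lap g V u - (inner ℝ (V u) (V u) : ℝ) • f u := by
  have hf := S.inner_source_self hΦ
  have hpush : Set.EqOn (fun v => push Φ (F v) (deltaT g h F v)) V U := fun v hv =>
    (S.push_deltaT_of_sphere hdim hΦ hv).trans (hV v hv).symm
  have hVs : ContDiffOn ℝ ∞ V U :=
    (S.contDiffOn_push S.contDiffOn_deltaT).congr fun _ hv => (hpush hv).symm
  have hVd : DifferentiableAt ℝ V u := differentiableAt_of_contDiffOn S.isOpen hVs hu
  have ho : ∀ v ∈ U, ∀ j, inner ℝ (vpd j f v) (V v) = (0 : ℝ) := fun v hv j => by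
    rw [hV v hv, inner_sub_right, real_inner_smul_right, real_inner_comm, S.source.inner_lap hv,
      S.source.inner_vpd_self hf hv]
    ring
  -- The normal correction in the Gauss formula is a multiple of `⟪∂ⱼf, V⟫`, which is zero: the
  -- covariant derivative of `V` is its ordinary derivative.
  have hN : ∀ j, Set.EqOn (fun v => push Φ (F v) (pullbackNabla h F j (deltaT g h F) v))
      (vpd j V) U := fun j v hv => by
    have h1 := S.push_pullbackNabla S.contDiffOn_deltaT hv j
    rw [S.sum_smul_hess_of_sphere hdim hΦ hv] at h1
    have h2 : push Φ (F v) (deltaT g h F v) = V v := hpush hv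
    rw [h2, ho v hv, vpd_congr S.isOpen hpush j hv, zero_smul, neg_zero, sub_zero] at h1
    exact h1
  -- At second order the correction survives, since `∂ⱼV` need not be normal to `M`.
  have hNN : ∀ i j, push Φ (F u) (pullbackNabla h F i (pullbackNabla h F j (deltaT g h F)) u) =
      vpd i (vpd j V) u + (inner ℝ (vpd i f u) (vpd j V u) : ℝ) • f u := fun i j => by
    have h1 := S.push_pullbackNabla (S.contDiffOn_pullbackNabla S.contDiffOn_deltaT j) hu i
    rw [S.sum_smul_hess_of_sphere hdim hΦ hu] at h1
    have h2 : push Φ (F u) (pullbackNabla h F j (deltaT g h F) u) = vpd j V u := hN j hu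
    rw [h2, vpd_congr S.isOpen (hN j) i hu, sub_neg_eq_add] at h1
    exact h1
  have hN' : ∀ k, push Φ (F u) (pullbackNabla h F k (deltaT g h F) u) = vpd k V u :=
    fun k => hN k hu
  -- Since `V ⊥ ∂ᵢf`, moving the derivative turns `⟪∂ᵢf, ∂ⱼV⟫` into `-⟪∂ⱼ∂ᵢf, V⟫`, with trace `⟪lap
  -- g f, V⟫`; this is `|V|²` because `f ⊥ V`.
  have hVV : inner ℝ (V u) (V u) = ∑ i, ∑ j, (g u)⁻¹ i j * inner ℝ (vpd i f u) (vpd j V u) := by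
    have h1 : inner ℝ (V u) (V u) = inner ℝ (lap g f u) (V u) := by
      have hfV : inner ℝ (f u) (V u) = (0 : ℝ) := by
        rw [hV u hu, inner_sub_right, real_inner_comm, S.source.inner_lap_self hf hu,
          real_inner_smul_right, hf u hu]
        ring
      nth_rw 1 [hV u hu]
      rw [inner_sub_left, real_inner_smul_left, hfV]
      ring
    rw [h1, lap, inner_neg_left, sum_inner, ← Finset.sum_neg_distrib]
    refine Finset.sum_congr rfl fun i _ => ?_
    rw [sum_inner, ← Finset.sum_neg_distrib]
    refine Finset.sum_congr rfl fun j _ => ?_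
    rw [real_inner_smul_left, hess, inner_sub_left, sum_inner, vpd_comm S.isOpen
      S.source.contDiffOn i j hu, inner_vpd_of_inner_zero S.isOpen
      (S.source.differentiableAt_vpd hu i) hVd (fun v hv => ho v hv i) hu j]
    simp [real_inner_smul_left, ho u hu]
  rw [roughLaplacian, push_divergence, hVV]
  simp only [hNN, hN', lap, hess, smul_add, smul_sub, Finset.sum_add_distrib,
    Finset.sum_sub_distrib, smul_smul, Finset.sum_smul]
  abel

/-- `V` is any function agreeing with the tension field on `U`, so that a closed form can be
substituted before its Laplacian is taken. -/
theorem push_bitension_of_sphere (S : IsPatchMap g f U h Φ Y F)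
    (hdim : n + 1 = Module.finrank ℝ E) (hΦ : ∀ y ∈ Y, inner ℝ (Φ y) (Φ y) = (1 : ℝ))
    {V : Eu m → E} (hV : ∀ v ∈ U, V v = lap g f v - (m : ℝ) • f v) (hu : u ∈ U) (k : ℝ) :
    push Φ (F u) (roughLaplacian g h F (deltaT g h F) u
        - curvatureTrace g h F (deltaT g h F) u + k • deltaT g h F u) =
      lap g V u - (inner ℝ (V u) (V u) : ℝ) • f u + (k - m) • V u := by
  have hf := S.inner_source_self hΦ
  have hp : push Φ (F u) (deltaT g h F u) = V u :=
    (S.push_deltaT_of_sphere hdim hΦ hu).trans (hV u hu).symm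
  have ho : ∀ j, inner ℝ (vpd j f u) (push Φ (F u) (deltaT g h F u)) = (0 : ℝ) := fun j => by
    rw [hp, hV u hu, inner_sub_right, real_inner_smul_right, real_inner_comm,
      S.source.inner_lap hu, S.source.inner_vpd_self hf hu]
    ring
  rw [map_add, map_sub, map_smul, S.push_roughLaplacian_deltaT_of_sphere hdim hΦ hV hu,
    S.push_curvatureTrace_of_sphere hdim hΦ hu ho, hp, sub_smul]
  abel

/-- In a hypersphere of radius `a` at height `b`, the tension field of a submanifold that is
biharmonic of index `m (1 - b² / a²)` in the unit sphere is determined. -/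
theorem lap_eq_of_bitension_eq_zero (S : IsPatchMap g f U h Φ Y F)
    (hdim : n + 1 = Module.finrank ℝ E) (hΦ : ∀ y ∈ Y, inner ℝ (Φ y) (Φ y) = (1 : ℝ))
    {e : E} {a b : ℝ} (he : inner ℝ e e = (1 : ℝ)) (ha : a ≠ 0) (hb : b ≠ 0)
    (hab : b ^ 2 = 1 - a ^ 2) (hfe : ∀ v ∈ U, inner ℝ (f v) e = b) (hu : u ∈ U)
    (h0 : roughLaplacian g h F (deltaT g h F) u - curvatureTrace g h F (deltaT g h F) u
      + (m * (1 - b ^ 2 / a ^ 2) : ℝ) • deltaT g h F u = 0) :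
    lap g f u = (m / a ^ 2 : ℝ) • (f u - b • e) := by
  have hf := S.inner_source_self hΦ
  set V : Eu m → E := fun v => lap g f v - (m : ℝ) • f v with hV
  have hT : ∀ v ∈ U, inner ℝ (lap g f v) e = (0 : ℝ) := fun v hv =>
    inner_lap_of_inner_const S.isOpen S.source.contDiffOn hfe hv
  have hVe : ∀ v ∈ U, inner ℝ (V v) e = - (m * b) := fun v hv => by
    rw [hV, inner_sub_left, real_inner_smul_left, hT v hv, hfe v hv]
    ring
  have hVs := S.contDiffOn_tension hdim hΦ
  have h1 := S.push_bitension_of_sphere hdim hΦ (V := V) (fun _ _ => rfl) hu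
    (m * (1 - b ^ 2 / a ^ 2))
  rw [h0, map_zero] at h1
  -- Only the `e`-component of the equation is needed; `lap g V` has none, as `⟪V, e⟫` is constant.
  have h2 := congrArg (inner ℝ · e) h1
  simp only [inner_zero_left, inner_add_left, inner_sub_left, real_inner_smul_left,
    inner_lap_of_inner_const (w := V) S.isOpen hVs hVe hu, hfe u hu, hVe u hu] at h2
  have hVV : inner ℝ (V u) (V u) = inner ℝ (lap g f u) (lap g f u) - (m : ℝ) ^ 2 := by
    have hTf := S.source.inner_lap_self hf hu
    simp only [hV, inner_sub_left, inner_sub_right, real_inner_smul_left, real_inner_smul_right,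
      hTf, hf u hu, real_inner_comm (lap g f u) (f u)]
    ring
  have hTT : inner ℝ (lap g f u) (lap g f u) = (m : ℝ) ^ 2 / a ^ 2 := by
    have h3 : b * (inner ℝ (V u) (V u) - m ^ 2 * b ^ 2 / a ^ 2) = 0 := by
      linear_combination h2
    rcases mul_eq_zero.1 h3 with h4 | h4
    · exact absurd h4 hb
    · rw [hVV, hab] at h4
      field_simp at h4 ⊢
      linarith
  -- Equality case of Cauchy–Schwarz: the squared norm of the difference is `m²/a² - 2m²/a² + m²/a²
  -- = 0`.
  rw [← sub_eq_zero, ← inner_self_eq_zero (𝕜 := ℝ)]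
  have hTf := S.source.inner_lap_self hf hu
  simp only [inner_sub_left, inner_sub_right, real_inner_smul_left, real_inner_smul_right,
    hTf, hTT, hf u hu, hT u hu, he, hfe u hu, real_inner_comm (lap g f u) (f u),
    real_inner_comm (lap g f u) e, real_inner_comm (f u) e]
  field_simp
  linear_combination (-(m : ℝ) ^ 2) * hab

theorem bitension_eq_zero_of_lap_eq (S : IsPatchMap g f U h Φ Y F)
    (hdim : n + 1 = Module.finrank ℝ E) (hΦ : ∀ y ∈ Y, inner ℝ (Φ y) (Φ y) = (1 : ℝ))
    {e : E} {a b : ℝ} (he : inner ℝ e e = (1 : ℝ)) (ha : a ≠ 0)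
    (hab : b ^ 2 = 1 - a ^ 2) (hfe : ∀ v ∈ U, inner ℝ (f v) e = b) (hu : u ∈ U)
    (h0 : ∀ v ∈ U, lap g f v = (m / a ^ 2 : ℝ) • (f v - b • e)) :
    roughLaplacian g h F (deltaT g h F) u - curvatureTrace g h F (deltaT g h F) u
      + (m * (1 - b ^ 2 / a ^ 2) : ℝ) • deltaT g h F u = 0 := by
  have hf := S.inner_source_self hΦ
  apply S.target.push_injective (S.mapsTo hu)
  have hV : ∀ v ∈ U, (m * b ^ 2 / a ^ 2 : ℝ) • f v - (m / a ^ 2 * b : ℝ) • e =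
      lap g f v - (m : ℝ) • f v := fun v hv => by
    have h1 : (m * b ^ 2 / a ^ 2 : ℝ) = m / a ^ 2 - m := by
      rw [hab]
      field_simp
    rw [h0 v hv, h1, sub_smul, smul_sub, smul_smul]
    abel
  rw [S.push_bitension_of_sphere hdim hΦ (V := fun v => (m * b ^ 2 / a ^ 2 : ℝ) • f v -
    (m / a ^ 2 * b : ℝ) • e) hV hu, lap_smul_sub_const S.isOpen S.source.contDiffOn _ _ hu,
    h0 u hu, map_zero]
  have h2 : inner ℝ ((m * b ^ 2 / a ^ 2 : ℝ) • f u - (m / a ^ 2 * b : ℝ) • e)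
      ((m * b ^ 2 / a ^ 2 : ℝ) • f u - (m / a ^ 2 * b : ℝ) • e) = (m ^ 2 * b ^ 2 / a ^ 2 : ℝ) := by
    simp only [inner_sub_left, inner_sub_right, real_inner_smul_left, real_inner_smul_right,
      hf u hu, he, hfe u hu, real_inner_comm (f u) e]
    field_simp
    linear_combination (-(m : ℝ) ^ 2 * b ^ 2) * hab
  -- With `c = m b² / a²`, writing `|V|²` as `(m / a²) c - c²` makes the coefficients of `f` and `e`
  -- cancel identically, without further use of `hab`.
  have h3 : (m ^ 2 * b ^ 2 / a ^ 2 : ℝ) =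
      m / a ^ 2 * (m * b ^ 2 / a ^ 2) - m * b ^ 2 / a ^ 2 * (m * b ^ 2 / a ^ 2) := by
    field_simp
    linear_combination ((m : ℝ) ^ 2 * b ^ 2) * hab
  rw [h2, h3]
  module

/-- A submanifold of a hypersphere is not harmonic in the unit sphere. -/
theorem deltaT_ne_zero_of_sphere (S : IsPatchMap g f U h Φ Y F)
    (hdim : n + 1 = Module.finrank ℝ E) (hΦ : ∀ y ∈ Y, inner ℝ (Φ y) (Φ y) = (1 : ℝ))
    (hm : m ≠ 0) {e : E} {b : ℝ} (hb : b ≠ 0) (hfe : ∀ v ∈ U, inner ℝ (f v) e = b)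
    (hu : u ∈ U) : deltaT g h F u ≠ 0 := by
  intro h0
  have h1 := S.push_deltaT_of_sphere hdim hΦ hu
  rw [h0, map_zero] at h1
  have h2 := congrArg (inner ℝ · e) h1
  simp only [inner_zero_left, inner_sub_left, real_inner_smul_left, hfe u hu,
    inner_lap_of_inner_const S.isOpen S.source.contDiffOn hfe hu] at h2
  have : (m : ℝ) * b ≠ 0 := mul_ne_zero (by exact_mod_cast hm) hb
  exact this (by linarith)

end IsPatchMap

/-! ### From manifolds to patches -/

section Charts

variable {m n q : ℕ} {M N : Type*} [TopologicalSpace M] [ChartedSpace (Eu m) M]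
  [TopologicalSpace N] [ChartedSpace (Eu n) N]

/-- The part of the chart domain at `p` that `φ` maps to the chart domain at `φ p`. -/
def chartDomain (φ : M → N) (p : M) : Set (Eu m) :=
  (chartAt (Eu m) p).target ∩
    (chartAt (Eu m) p).symm ⁻¹' (φ ⁻¹' (chartAt (Eu n) (φ p)).source)

theorem isOpen_chartDomain {φ : M → N} (hφ : Continuous φ) (p : M) :
    IsOpen (chartDomain (m := m) (n := n) φ p) :=
  (chartAt (Eu m) p).isOpen_inter_preimage_symm ((chartAt (Eu n) (φ p)).open_source.preimage hφ)

theorem mem_chartDomain (φ : M → N) (p : M) :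
    chartAt (Eu m) p p ∈ chartDomain (m := m) (n := n) φ p := by
  simp [chartDomain]

variable [IsManifold (𝓡 m) ∞ M] [IsManifold (𝓡 n) ∞ N]

/-- An immersed manifold, read in a preferred chart, is a patch. -/
theorem isPatch_metricInChart {ψ : M → Eu q} (hψ : ContMDiff (𝓡 m) (𝓡 q) ∞ ψ)
    (hi : ∀ p, Function.Injective (mfderiv (𝓡 m) (𝓡 q) ψ p)) (p : M) :
    IsPatch (metricInChart (inducedMetric ψ) p) (fun u => ψ ((chartAt (Eu m) p).symm u))
      (chartAt (Eu m) p).target := by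
  have hc : (chartAt (Eu m) p).MDifferentiable (𝓡 m) (𝓡 m) := mdifferentiable_chart p
  have hfd : ∀ u ∈ (chartAt (Eu m) p).target, ∀ w : Eu m,
      fderiv ℝ (fun u => ψ ((chartAt (Eu m) p).symm u)) u w =
        mfderiv (𝓡 m) (𝓡 q) ψ ((chartAt (Eu m) p).symm u)
          (mfderiv (𝓡 m) (𝓡 m) (chartAt (Eu m) p).symm u w) := fun u hu w => by
    rw [← mfderiv_eq_fderiv]
    exact mfderiv_comp_apply u (hψ.mdifferentiable (by simp) _) (hc.mdifferentiableAt_symm hu) w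
  refine ⟨(chartAt (Eu m) p).open_target, ?_, fun u hu i j => ?_, fun u hu => ?_⟩
  · exact (hψ.comp_contMDiffOn (contMDiffOn_chart_symm (x := p))).contDiffOn
  · simp only [metricInChart, Matrix.of_apply, inducedMetric, vpd, hfd u hu]
  · have hinj : Function.Injective
        (fderiv ℝ (fun u => ψ ((chartAt (Eu m) p).symm u)) u) := fun v w hvw => by
      rw [hfd u hu, hfd u hu] at hvw
      exact hc.symm.mfderiv_injective hu (hi _ hvw)
    have hb : LinearIndependent ℝ fun i : Fin m => EuclideanSpace.single i (1 : ℝ) := by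
      have h := (EuclideanSpace.basisFun (Fin m) ℝ).toBasis.linearIndependent
      have he : ⇑(EuclideanSpace.basisFun (Fin m) ℝ).toBasis =
          fun i => EuclideanSpace.single i (1 : ℝ) := by
        ext i
        simp
      rwa [he] at h
    exact hb.map' (fderiv ℝ (fun u => ψ ((chartAt (Eu m) p).symm u)) u).toLinearMap
      (LinearMap.ker_eq_bot.2 hinj)

/-- A map between immersed manifolds, read in preferred charts, is a map between patches. -/
theorem isPatchMap_mapInCharts {φ : M → N} (hφ : ContMDiff (𝓡 m) (𝓡 n) ∞ φ) {ψ : N → Eu q}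
    (hψ : ContMDiff (𝓡 n) (𝓡 q) ∞ ψ)
    (hi : ∀ p, Function.Injective (mfderiv (𝓡 n) (𝓡 q) ψ p))
    (hφi : ∀ p, Function.Injective (mfderiv (𝓡 m) (𝓡 n) φ p)) (p : M) :
    IsPatchMap (metricInChart (m := m) (inducedMetric (m := m) fun p => ψ (φ p)) p)
      (fun u => ψ (φ ((chartAt (Eu m) p).symm u))) (chartDomain (m := m) (n := n) φ p)
      (metricInChart (inducedMetric ψ) (φ p)) (fun y => ψ ((chartAt (Eu n) (φ p)).symm y))
      (chartAt (Eu n) (φ p)).target (mapInCharts φ p) := by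
  have hinj : ∀ p, Function.Injective (mfderiv (𝓡 m) (𝓡 q) (fun p => ψ (φ p)) p) :=
    fun p v w hvw => by
      have h1 := fun v => mfderiv_comp_apply p (hψ.mdifferentiable (by simp) (φ p))
        (hφ.mdifferentiable (by simp) p) v
      have h2 := (h1 v).symm.trans (hvw.trans (h1 w))
      exact hφi p (hi _ h2)
  refine ⟨(isPatch_metricInChart (hψ.comp hφ) hinj p).mono
    (isOpen_chartDomain hφ.continuous p) Set.inter_subset_left,
    isPatch_metricInChart hψ hi (φ p), ?_, fun u hu => ?_, fun u hu => ?_⟩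
  · exact ((contMDiffOn_chart (x := φ p)).comp (hφ.comp_contMDiffOn
      ((contMDiffOn_chart_symm (x := p)).mono Set.inter_subset_left))
      fun u hu => hu.2).contDiffOn
  · exact (chartAt (Eu n) (φ p)).map_source hu.2
  · simp only [mapInCharts]
    rw [(chartAt (Eu n) (φ p)).left_inv hu.2]

end Charts

/-! ### Hyperspheres as manifolds -/

section Hypersphere

variable (d : ℕ) (a : Set.Ioc (0 : ℝ) 1)

/-- The charts of the hypersphere are those of the unit sphere composed with this homeomorphism, so
in charts it is the identity. -/
theorem contMDiff_hypersphereHomeo :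
    ContMDiff (𝓡 d) (𝓡 d) ∞ (hypersphereHomeo d a) := by
  intro p
  rw [contMDiffAt_iff]
  refine ⟨(hypersphereHomeo d a).continuous.continuousAt, ?_⟩
  refine contDiffWithinAt_id.congr_of_eventuallyEq_of_mem ?_ (by simp)
  refine Filter.eventuallyEq_of_mem (s := (chartAt (Eu d) (hypersphereHomeo d a p)).target)
    (mem_nhdsWithin_of_mem_nhds ((chartAt (Eu d) (hypersphereHomeo d a p)).open_target.mem_nhds
      ?_)) fun u hu => ?_
  · exact mem_chart_target _ _
  · simp [chartAt, ChartedSpace.chartAt] at hu ⊢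

theorem contMDiff_hypersphereHomeo_symm :
    ContMDiff (𝓡 d) (𝓡 d) ∞ (hypersphereHomeo d a).symm := by
  intro p
  rw [contMDiffAt_iff]
  refine ⟨(hypersphereHomeo d a).symm.continuous.continuousAt, ?_⟩
  refine contDiffWithinAt_id.congr_of_eventuallyEq_of_mem ?_ (by simp)
  refine Filter.eventuallyEq_of_mem (s := (chartAt (Eu d) p).target)
    (mem_nhdsWithin_of_mem_nhds ((chartAt (Eu d) p).open_target.mem_nhds
      ?_)) fun u hu => ?_
  · exact mem_chart_target _ _
  · simp [chartAt, ChartedSpace.chartAt] at hu ⊢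

theorem coe_eq_hypersphereHomeo (p : hypersphere d a) : (p : Eu (d + 2)) =
    WithLp.toLp 2 (Fin.snoc (α := fun _ => ℝ) (fun i => (a : ℝ) * (hypersphereHomeo d a p).1 i)
      (height a)) :=
  congrArg Subtype.val ((hypersphereHomeo d a).symm_apply_apply p).symm

theorem contMDiff_coe_hypersphere :
    ContMDiff (𝓡 d) (𝓡 (d + 2)) ∞ (fun p : hypersphere d a => (p : Eu (d + 2))) := by
  have h1 : ContDiff ℝ ∞ fun x : Eu (d + 1) => (WithLp.toLp 2
      (Fin.snoc (α := fun _ => ℝ) (fun i => (a : ℝ) * x i) (height a)) : Eu (d + 2)) := by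
    rw [contDiff_piLp]
    intro i
    refine Fin.lastCases ?_ (fun j => ?_) i
    · simpa using contDiff_const
    · simp only [Fin.snoc_castSucc]
      fun_prop
  have := Fact.mk (@finrank_euclideanSpace_fin ℝ _ (d + 1))
  have h2 := h1.contMDiff.comp (contMDiff_coe_sphere.comp (contMDiff_hypersphereHomeo d a))
  refine h2.congr fun p => ?_
  exact coe_eq_hypersphereHomeo d a p

/-- Following the inclusion by the linear map `x ↦ a⁻¹ (x₀, …, x_d)` gives the homothety onto the
unit sphere followed by its inclusion, and both of these have injective derivative. -/
theorem mfderiv_coe_hypersphere_injective (p : hypersphere d a) :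
    Function.Injective
      (mfderiv (𝓡 d) (𝓡 (d + 2)) (fun p : hypersphere d a => (p : Eu (d + 2))) p) := by
  have h1 : ContMDiff (𝓡 (d + 2)) (𝓡 (d + 1)) ∞ fun x : Eu (d + 2) => ((a : ℝ)⁻¹ •
      (WithLp.toLp 2 (fun i : Fin (d + 1) => x i.castSucc) : Eu (d + 1)) : Eu (d + 1)) := by
    refine ContDiff.contMDiff ?_
    fun_prop
  have hs := (contMDiff_hypersphereHomeo_symm d a).mdifferentiable (by simp)
    (hypersphereHomeo d a p)
  have hh := (contMDiff_hypersphereHomeo d a).mdifferentiable (by simp) p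
  have hc := (contMDiff_coe_hypersphere d a).mdifferentiable (by simp) p
  have hinj : Function.Injective (mfderiv (𝓡 d) (𝓡 d) (hypersphereHomeo d a) p) := by
    have h3 := mfderiv_comp p hs hh
    have h4 : (hypersphereHomeo d a).symm ∘ hypersphereHomeo d a = id := by
      ext p; simp
    rw [h4, mfderiv_id] at h3
    intro v w hvw
    have h5 := fun v => DFunLike.congr_fun h3 v
    exact (h5 v).trans ((congrArg _ hvw).trans (h5 w).symm)
  have := Fact.mk (@finrank_euclideanSpace_fin ℝ _ (d + 1))
  intro v w hvw
  apply hinj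
  apply injective_mvfderiv_subtypeVal_sphere (hypersphereHomeo d a p)
  have h6 := fun v => mfderiv_comp_apply p
    ((contMDiff_coe_sphere (m := ∞)).mdifferentiable (by simp) (hypersphereHomeo d a p)) hh v
  have h7 := fun v => mfderiv_comp_apply p (h1.mdifferentiable (by simp) (p : Eu (d + 2))) hc v
  exact (h6 v).symm.trans ((h7 v).trans ((congrArg _ hvw).trans ((h7 w).symm.trans (h6 w))))

end Hypersphere

/-! ### Submanifolds of a hypersphere, seen in both targets -/

section Submanifold

variable {m d : ℕ} {a : Set.Ioc (0 : ℝ) 1} {M : Type*} [TopologicalSpace M]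
  [ChartedSpace (Eu m) M] [IsManifold (𝓡 m) ∞ M] {φ : M → hypersphere d a}

theorem contMDiff_hypersphereIncl_comp (hφ : ContMDiff (𝓡 m) (𝓡 d) ∞ φ) :
    ContMDiff (𝓡 m) (𝓡 (d + 1)) ∞ (hypersphereIncl d a ∘ φ) := by
  have := Fact.mk (@finrank_euclideanSpace_fin ℝ _ (d + 2))
  exact ContMDiff.codRestrict_sphere (n := d + 1) ((contMDiff_coe_hypersphere d a).comp hφ)
    fun p => hypersphere_subset d a (φ p).2

theorem mfderiv_hypersphereIncl_comp_injective (hφ : ContMDiff (𝓡 m) (𝓡 d) ∞ φ)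
    (himm : ∀ p : M, Function.Injective (mfderiv (𝓡 m) (𝓡 d) φ p)) (p : M) :
    Function.Injective (mfderiv (𝓡 m) (𝓡 (d + 1)) (hypersphereIncl d a ∘ φ) p) := by
  have := Fact.mk (@finrank_euclideanSpace_fin ℝ _ (d + 2))
  intro v w hvw
  apply himm p
  apply mfderiv_coe_hypersphere_injective d a (φ p)
  have h1 := fun v => mfderiv_comp_apply p
    ((contMDiff_coe_hypersphere d a).mdifferentiable (by simp) (φ p))
    (hφ.mdifferentiable (by simp) p) v
  have h2 := fun v => mfderiv_comp_apply p
    ((contMDiff_coe_sphere (n := d + 1) (m := ∞)).mdifferentiable (by simp)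
      (hypersphereIncl d a (φ p)))
    ((contMDiff_hypersphereIncl_comp hφ).mdifferentiable (by simp) p) v
  exact (h1 v).symm.trans ((h2 v).trans ((congrArg _ hvw).trans ((h2 w).symm.trans (h1 w))))

theorem isPatchMap_hypersphere (hφ : ContMDiff (𝓡 m) (𝓡 d) ∞ φ)
    (himm : ∀ p : M, Function.Injective (mfderiv (𝓡 m) (𝓡 d) φ p)) (p : M) :
    IsPatchMap (metricInChart (m := m) (inducedMetric (m := m) fun p => (φ p : Eu (d + 2))) p)
      (fun u => (φ ((chartAt (Eu m) p).symm u) : Eu (d + 2)))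
      (chartDomain (m := m) (n := d) φ p)
      (metricInChart (hypersphereMetric d a) (φ p))
      (fun y => ((chartAt (Eu d) (φ p)).symm y : Eu (d + 2)))
      (chartAt (Eu d) (φ p)).target (mapInCharts φ p) := by
  have : IsManifold (𝓡 d) ∞ (hypersphere d a) := IsManifold.of_le (n := ω) le_top
  exact isPatchMap_mapInCharts hφ (contMDiff_coe_hypersphere d a)
    (mfderiv_coe_hypersphere_injective d a) himm p

/-- The source metric and the Euclidean immersion are the same as in `isPatchMap_hypersphere`, so
both conditions concern one vector field `lap g f`; only the target and the chart domain change. -/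
theorem isPatchMap_sphere (hφ : ContMDiff (𝓡 m) (𝓡 d) ∞ φ)
    (himm : ∀ p : M, Function.Injective (mfderiv (𝓡 m) (𝓡 d) φ p)) (p : M) :
    IsPatchMap (metricInChart (m := m) (inducedMetric (m := m) fun p => (φ p : Eu (d + 2))) p)
      (fun u => (φ ((chartAt (Eu m) p).symm u) : Eu (d + 2)))
      (chartDomain (m := m) (n := d + 1) (hypersphereIncl d a ∘ φ) p)
      (metricInChart (roundMetric (d + 1)) ((hypersphereIncl d a ∘ φ) p))
      (fun y => ((chartAt (Eu (d + 1)) ((hypersphereIncl d a ∘ φ) p)).symm y : Eu (d + 2)))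
      (chartAt (Eu (d + 1)) ((hypersphereIncl d a ∘ φ) p)).target
      (mapInCharts (hypersphereIncl d a ∘ φ) p) := by
  have := Fact.mk (@finrank_euclideanSpace_fin ℝ _ (d + 2))
  have : IsManifold (𝓡 (d + 1)) ∞ (Sph (d + 1)) := IsManifold.of_le (n := ω) le_top
  exact isPatchMap_mapInCharts (contMDiff_hypersphereIncl_comp hφ)
    (ψ := fun x : Sph (d + 1) => (x : Eu (d + 2))) contMDiff_coe_sphere
    injective_mvfderiv_subtypeVal_sphere (mfderiv_hypersphereIncl_comp_injective hφ himm) p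

end Submanifold

theorem inner_coe_sphere_self {n : ℕ} (x : Sph n) :
    inner ℝ (x : Eu (n + 1)) (x : Eu (n + 1)) = (1 : ℝ) := by
  rw [real_inner_self_eq_norm_sq, mem_sphere_zero_iff_norm.1 x.2, one_pow]

theorem inner_coe_hypersphere_last {d : ℕ} {a : Set.Ioc (0 : ℝ) 1} (x : hypersphere d a) :
    inner ℝ (x : Eu (d + 2)) (EuclideanSpace.single (Fin.last (d + 1)) (1 : ℝ)) = height a := by
  simpa [EuclideanSpace.inner_single_right] using x.2.2

theorem height_ne_zero {a : Set.Ioc (0 : ℝ) 1} (ha : (a : ℝ) ≠ 1) : height a ≠ 0 := by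
  intro h
  have h1 := height_sq a
  rw [h] at h1
  have h2 : (a : ℝ) < 1 := lt_of_le_of_ne a.2.2 ha
  nlinarith [a.2.1]

end Biharm

end

theorem mainTheorem3 (m d : ℕ) (hm : 1 ≤ m) (a : Set.Ioc (0 : ℝ) 1) (ha : (a : ℝ) ≠ 1)
    (M : Type*) [TopologicalSpace M] [ChartedSpace (Biharm.Eu m) M] [IsManifold (𝓡 m) ∞ M]
    [Nonempty M] (φ : M → Biharm.hypersphere d a) (hφ : ContMDiff (𝓡 m) (𝓡 d) ∞ φ)
    (himm : ∀ p : M, Function.Injective (mfderiv (𝓡 m) (𝓡 d) φ p)) :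
    Biharm.IsHarmonic (Biharm.inducedMetric (m := m) fun p => (φ p : Biharm.Eu (d + 2)))
        (Biharm.hypersphereMetric d a) φ ↔
      Biharm.IsProperlyBiharmonicOfIndex (m * (1 - Biharm.height a ^ 2 / (a : ℝ) ^ 2))
        (Biharm.inducedMetric (m := m) fun p => (φ p : Biharm.Eu (d + 2)))
        (Biharm.roundMetric (d + 1)) (Biharm.hypersphereIncl d a ∘ φ) := by
  have ha0 : (a : ℝ) ≠ 0 := a.2.1.ne'
  have hb := Biharm.height_ne_zero ha
  have hab := Biharm.height_sq a
  have he : inner ℝ (EuclideanSpace.single (Fin.last (d + 1)) (1 : ℝ) : Biharm.Eu (d + 2))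
      (EuclideanSpace.single (Fin.last (d + 1)) (1 : ℝ)) = (1 : ℝ) := by
    simp
  have hdim1 : d + 2 = Module.finrank ℝ (Biharm.Eu (d + 2)) := by simp
  have hdim2 : d + 1 + 1 = Module.finrank ℝ (Biharm.Eu (d + 2)) := by simp
  have S1 := Biharm.isPatchMap_hypersphere hφ himm
  have S2 := Biharm.isPatchMap_sphere hφ himm
  have hm1 := Biharm.mem_chartDomain (m := m) (n := d) φ
  have hm2 := Biharm.mem_chartDomain (m := m) (n := d + 1) (Biharm.hypersphereIncl d a ∘ φ)
  have hlap : ∀ p, ∀ u ∈ Biharm.chartDomain (m := m) (n := d) φ p, _ :=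
    fun p u hu => (S1 p).deltaT_eq_zero_iff_lap_eq hdim1 he ha0 hab
      (fun y _ => Biharm.inner_coe_sphere_self (Biharm.hypersphereIncl d a
        ((chartAt (Biharm.Eu d) (φ p)).symm y)))
      (fun y _ => Biharm.inner_coe_hypersphere_last _) hu
  constructor
  · intro hh
    refine ⟨fun p => ?_, fun hn => ?_⟩
    · obtain ⟨U, hU, hUo, hpU⟩ := eventually_nhds_iff.1 (hh p)
      have hW := (hUo.inter (S1 p).isOpen).inter (S2 p).isOpen
      filter_upwards [hW.mem_nhds ⟨⟨hpU, hm1 p⟩, hm2 p⟩] with u hu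
      exact ((S2 p).mono hW Set.inter_subset_right).bitension_eq_zero_of_lap_eq hdim2
        (fun y _ => Biharm.inner_coe_sphere_self _) he ha0 hab
        (fun v _ => Biharm.inner_coe_hypersphere_last _) hu
        fun v hv => (hlap p v hv.1.2).1 (hU v hv.1.1)
    · obtain ⟨p⟩ := ‹Nonempty M›
      exact (S2 p).deltaT_ne_zero_of_sphere hdim2 (fun y _ => Biharm.inner_coe_sphere_self _)
        (by omega) hb (fun v _ => Biharm.inner_coe_hypersphere_last _) (hm2 p)
        (hn p).self_of_nhds
  -- This direction is pointwise: the equation at `u` already determines `lap g f` at `u`.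
  · rintro ⟨hh, -⟩ p
    filter_upwards [(S1 p).isOpen.mem_nhds (hm1 p), (S2 p).isOpen.mem_nhds (hm2 p), hh p]
      with u hu1 hu2 hu
    exact (hlap p u hu1).2 ((S2 p).lap_eq_of_bitension_eq_zero hdim2
      (fun y _ => Biharm.inner_coe_sphere_self _) he ha0 hb hab
      (fun v _ => Biharm.inner_coe_hypersphere_last _) hu2 hu)
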